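/- Let $\mathbb R^{3\times3}_{sym}$ be the space of real symmetric $3\times 3$ matrices, with $A:B=\sum_{i,j}A_{ij}B_{ij}$ and $\|A\|=\sqrt{A:A}$, and let $I$ be the identity matrix. For $\sigma\in\mathbb R^{3\times3}_{sym}$ put $$p(\sigma)=\tfrac13 I:\sigma,\quad s(\sigma)=\sigma-p(\sigma)I,\quad \varrho(\sigma)=\|s(\sigma)\|,\quad J_2=\tfrac12 s:s,\quad J_3=\tfrac13 s^3:I,$$ and, where $\varrho(\sigma)\ne0$, $$\theta(\sigma)=\tfrac13\arccos\Big(\tfrac{3\sqrt3}{2}\tfrac{J_3}{J_2^{3/2}}\Big),\qquad n(\sigma)=\frac{s(\sigma)}{\varrho(\sigma)}.$$ Let $e\in[\tfrac12,1]$ and $$r_e(x)=\frac{4(1-e^2)x^2+(2e-1)^2}{2(1-e^2)x+(2e-1)\sqrt{4(1-e^2)x^2+5e^2-4e}},$$ and let $\varrho_e(\sigma)=\varrho(\sigma)\,r_e(\cos\theta(\sigma))$, with $\varrho_e(\sigma)=0$ where $\varrho(\sigma)=0$. A function $F:X\to Y$ between finite-dimensional normed spaces is called strongly semismooth at $x\in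 X$ if it is Lipschitz continuous in a neighborhood of $x$, all one-sided directional derivatives $\lim_{t\to0+}(F(x+th)-F(x))/t$, $h\in X$, exist, and $F(x+h)-F(x)-Vh=O(\|h\|^2)$ as $h\to0$, uniformly in $V\in\partial F(x+h)$; here $\partial F(y)$ is Clarke's generalized Jacobian, the convex hull of all limits of Fréchet derivatives $DF(y_k)$ along sequences $y_k\to y$ of points of differentiability. $F$ is strongly semismooth on $X$ if it is so at every point of $X$. Then $\varrho$ and $\varrho_e$ are strongly semismooth on $\mathbb R^{3\times3}_{sym}$. Moreover, if $\hat p,\hat\varrho:\mathbb R^{3\times3}_{sym}\to\mathbb R$ are strongly semismooth on $\mathbb R^{3\times3}_{sym}$ and $\hat\varrho(\sigma)=0$ whenever $\varrho(\sigma)=0$, then the functions $$\hat\varrho_e(\sigma)=\begin{cases}\hat\varrho(\sigma)\,r_e(\cos\theta(\sigma)),&\varrho(\sigma)\ne0,\\0,&\varrho(\sigma)=0,\end{cases}\qquad S(\sigma)=\begin{cases}\hat p(\sigma)I+\hat\varrho(\sigma)n(\sigma),&\varrho(\sigma)\ne0,\\ \hat p(\sigma)I,&\varrho(\sigma)=0\end{cases}$$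 are strongly semismooth on $\mathbb R^{3\times3}_{sym}$. -/

import Mathlib

open Filter Topology

/-! ### Strongly semismooth functions between normed spaces -/

section Semismooth

variable {X Y : Type*} [NormedAddCommGroup X] [NormedSpace ℝ X]
  [NormedAddCommGroup Y] [NormedSpace ℝ Y]

/-- The generalized Jacobian of `F` at `x` in the sense of Clarke: the convex hull of all limits
of Fréchet derivatives `DF (u k)` along sequences `u k → x` of points of differentiability. -/
def clarkeJacobian (F : X → Y) (x : X) : Set (X →L[ℝ] Y) :=
  convexHull ℝ {V : X →L[ℝ] Y | ∃ u : ℕ → X, (∀ k, DifferentiableAt ℝ F (u k)) ∧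
    Tendsto u atTop (𝓝 x) ∧ Tendsto (fun k => fderiv ℝ F (u k)) atTop (𝓝 V)}

/-- `F` is directionally differentiable at `x`: all one-sided directional derivatives exist. -/
def DirectionallyDifferentiableAt (F : X → Y) (x : X) : Prop :=
  ∀ h : X, ∃ d : Y, Tendsto (fun t : ℝ => t⁻¹ • (F (x + t • h) - F x)) (𝓝[>] (0 : ℝ)) (𝓝 d)

/-- `F` is strongly semismooth at `x`: it is Lipschitz near `x`, directionally differentiable
at `x`, and `F (x + h) - F x - V h = O(‖h‖ ^ 2)` as `h → 0`, uniformly in `V ∈ ∂F (x + h)`. -/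
structure StronglySemismoothAt (F : X → Y) (x : X) : Prop where
  lipschitz : ∃ K : NNReal, ∃ U ∈ 𝓝 x, LipschitzOnWith K F U
  directional : DirectionallyDifferentiableAt F x
  quadratic : ∃ C : ℝ, ∀ᶠ h : X in 𝓝 0, ∀ V ∈ clarkeJacobian F (x + h),
    ‖F (x + h) - F x - V h‖ ≤ C * ‖h‖ ^ 2

/-- `F` is strongly semismooth on the whole space. -/
def StronglySemismooth (F : X → Y) : Prop :=
  ∀ x, StronglySemismoothAt F x

end Semismooth

/-! ### Symmetric tensors and their invariants -/

/-- The subspace of symmetric matrices among the real `3 × 3` matrices. -/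
def symmetricMatrices : Submodule ℝ (Matrix (Fin 3) (Fin 3) ℝ) where
  carrier := {A | A.IsSymm}
  add_mem' hA hB := hA.add hB
  zero_mem' := Matrix.isSymm_zero
  smul_mem' c _ hA := hA.smul c

/-- The space of real symmetric `3 × 3` tensors. -/
def SymTensor : Type := symmetricMatrices

namespace SymTensor

noncomputable section

section Norm

-- Symmetric tensors carry the Frobenius norm (and only its topology).
attribute [local instance] Matrix.frobeniusNormedAddCommGroup Matrix.frobeniusNormedSpace

instance : NormedAddCommGroup SymTensor := inferInstanceAs (NormedAddCommGroup symmetricMatrices)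

instance : NormedSpace ℝ SymTensor := inferInstanceAs (NormedSpace ℝ symmetricMatrices)

end Norm

/-- The matrix of a symmetric tensor. -/
def mat (σ : SymTensor) : Matrix (Fin 3) (Fin 3) ℝ := σ.1

/-- The identity tensor `I`. -/
def one : SymTensor := ⟨1, Matrix.isSymm_one⟩

/-- The double contraction `A : B = ∑ i j, A i j * B i j`. -/
def contract (A B : SymTensor) : ℝ :=
  ∑ i, ∑ j, A.mat i j * B.mat i j

/-- The hydrostatic pressure `p = (I : σ) / 3`. -/
def p (σ : SymTensor) : ℝ := contract one σ / 3

/-- The deviatoric part `s = σ - p I`. -/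
def s (σ : SymTensor) : SymTensor := σ - p σ • one

/-- The invariant `ϱ = √(s : s)`. -/
def rho (σ : SymTensor) : ℝ := Real.sqrt (contract (s σ) (s σ))

/-- `J₂ = (s : s) / 2`. -/
def J2 (σ : SymTensor) : ℝ := contract (s σ) (s σ) / 2

/-- `J₃ = (s³ : I) / 3`. -/
def J3 (σ : SymTensor) : ℝ := ((s σ).mat ^ 3).trace / 3

/-- The Lode angle `θ = arccos ((3 √3 / 2) J₃ / J₂ ^ (3/2)) / 3`; meaningful for `rho σ ≠ 0`. -/
def lode (σ : SymTensor) : ℝ :=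
  Real.arccos (3 * Real.sqrt 3 / 2 * (J3 σ / J2 σ ^ (3 / 2 : ℝ))) / 3

/-- The flow direction `n = s / ϱ`; meaningful for `rho σ ≠ 0`. -/
def n (σ : SymTensor) : SymTensor := (rho σ)⁻¹ • s σ

/-- The function `r_e` with eccentricity `e`, evaluated at `x = cos θ`. -/
def rE (e x : ℝ) : ℝ :=
  (4 * (1 - e ^ 2) * x ^ 2 + (2 * e - 1) ^ 2) /
    (2 * (1 - e ^ 2) * x +
      (2 * e - 1) * Real.sqrt (4 * (1 - e ^ 2) * x ^ 2 + 5 * e ^ 2 - 4 * e))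

/-- The invariant `ϱ_e = ϱ r_e(cos θ)`; its value is `0` where `ϱ = 0`. -/
def rhoE (e : ℝ) (σ : SymTensor) : ℝ := rho σ * rE e (Real.cos (lode σ))

/-- The function `ϱ̂ r_e(cos θ)`, extended by `0` where `ϱ = 0`. -/
def rhoHatE (e : ℝ) (rhoHat : SymTensor → ℝ) (σ : SymTensor) : ℝ :=
  if rho σ ≠ 0 then rhoHat σ * rE e (Real.cos (lode σ)) else 0

/-- The tensor function `S = p̂ I + ϱ̂ n`, extended by `p̂ I` where `ϱ = 0`. -/
def S (pHat rhoHat : SymTensor → ℝ) (σ : SymTensor) : SymTensor :=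
  if rho σ ≠ 0 then pHat σ • one + rhoHat σ • n σ else pHat σ • one

end

end SymTensor

/-! Smoothness can fail in two places: where the largest eigenvalue of `s` is multiple, because of
`θ`, and where `ϱ = 0`.

The largest eigenvalue `μ` of `s` satisfies `μ³ - J₂ μ - J₃ = 0`. The triple angle formula turns
this into `cos θ = √(3/2) μ / ϱ` (`cos_lode`), with values in `[1/2, 1]`, where `r_e` is `C²`. The
maximal eigenvalue of a linear family of symmetric operators is strongly semismooth
(`stronglySemismooth_of_isMaxRayleigh`), so a chain rule settles the points with `ϱ ≠ 0`.

Where `ϱ = 0`, the critical terms are products `a • k`: `a` is strongly semismooth and vanishes with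
`ϱ`, while `k`, which is `r_e(cos θ)` or `n`, is bounded and positively homogeneous of degree `0` in
`s`. Such a `k` is constant on rays from a point `x` with `ϱ = 0`, so the error of `a • k` along `y
- x` is the error of `a` times `k y`. The product is Lipschitz because `|a| ≤ K ϱ` locally and `k`
is Lipschitz with weight `ϱ` (`RayStronglySemismoothAt.smul_of_const_on_rays`).

These arguments need derivatives of `a` at points where only the product is known to be
differentiable. Hence the calculus runs on one-sided derivatives at `y` along `y - x`. Passing from
them to Clarke's Jacobian is easy; the converse rests on Rademacher's theorem and an averaged mean
value inequality (`LipschitzWith.norm_sub_sub_smul_le`). -/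

/-! ### Calculus of strong semismoothness along rays -/

section SemismoothCalculus

variable {X Y Z : Type*} [NormedAddCommGroup X] [NormedSpace ℝ X]
  [NormedAddCommGroup Y] [NormedSpace ℝ Y] [NormedAddCommGroup Z] [NormedSpace ℝ Z]

/-- `d` is the one-sided derivative of `F` at `x` in the direction `v`. -/
def HasDirDeriv (F : X → Y) (x v : X) (d : Y) : Prop :=
  HasDerivWithinAt (fun t : ℝ => F (x + t • v)) d (Set.Ioi 0) 0

theorem hasDirDeriv_iff_tendsto {F : X → Y} {x v : X} {d : Y} :
    HasDirDeriv F x v d ↔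
      Tendsto (fun t : ℝ => t⁻¹ • (F (x + t • v) - F x)) (𝓝[>] (0 : ℝ)) (𝓝 d) := by
  unfold HasDirDeriv
  rw [hasDerivWithinAt_iff_tendsto_slope' (by simp)]
  simp [slope_fun_def]

theorem directionallyDifferentiableAt_iff {F : X → Y} {x : X} :
    DirectionallyDifferentiableAt F x ↔ ∀ v, ∃ d, HasDirDeriv F x v d := by
  simp only [DirectionallyDifferentiableAt, hasDirDeriv_iff_tendsto]

theorem HasDirDeriv.unique {F : X → Y} {x v : X} {d d' : Y} (h : HasDirDeriv F x v d)
    (h' : HasDirDeriv F x v d') : d = d' :=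
  tendsto_nhds_unique (hasDirDeriv_iff_tendsto.1 h) (hasDirDeriv_iff_tendsto.1 h')

theorem HasFDerivAt.hasDirDeriv {F : X → Y} {x : X} {F' : X →L[ℝ] Y} (h : HasFDerivAt F F' x)
    (v : X) : HasDirDeriv F x v (F' v) := by
  have h1 : HasDerivWithinAt (fun t : ℝ => x + t • v) v (Set.Ioi 0) 0 := by
    simpa using (((hasDerivAt_id (0 : ℝ)).smul_const v).const_add x).hasDerivWithinAt
  have h2 : HasFDerivAt F F' (x + (0 : ℝ) • v) := by simpa using h
  exact h2.comp_hasDerivWithinAt (0 : ℝ) h1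

theorem HasDirDeriv.comp_hasFDerivAt {G : X → Y} {φ : Y → Z} {x v : X} {d : Y}
    {φ' : Y →L[ℝ] Z} (hφ : HasFDerivAt φ φ' (G x)) (h : HasDirDeriv G x v d) :
    HasDirDeriv (fun z => φ (G z)) x v (φ' d) := by
  have h2 : HasFDerivAt φ φ' (G (x + (0 : ℝ) • v)) := by simpa using hφ
  exact h2.comp_hasDerivWithinAt (0 : ℝ) h

theorem HasDirDeriv.prodMk {F : X → Y} {G : X → Z} {x v : X} {d : Y} {d' : Z}
    (h : HasDirDeriv F x v d) (h' : HasDirDeriv G x v d') :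
    HasDirDeriv (fun z => (F z, G z)) x v (d, d') :=
  HasDerivWithinAt.prodMk h h'

theorem HasDirDeriv.congr_pos {F G : X → Y} {x v : X} {d : Y} (h : HasDirDeriv F x v d)
    (hx : G x = F x) (hpos : ∀ t : ℝ, 0 < t → G (x + t • v) = F (x + t • v)) :
    HasDirDeriv G x v d :=
  HasDerivWithinAt.congr h (fun t ht => hpos t ht) (by simpa using hx)

/-- Strong semismoothness at `x`, expressed by the one-sided derivatives along the rays
emanating from `x` instead of the generalized Jacobian. -/
structure RayStronglySemismoothAt (F : X → Y) (x : X) : Prop where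
  lipschitz : ∃ K : NNReal, ∃ U ∈ 𝓝 x, LipschitzOnWith K F U
  directional : ∀ᶠ y in 𝓝 x, DirectionallyDifferentiableAt F y
  quadratic : ∃ C : ℝ, ∀ᶠ y in 𝓝 x, ∀ d : Y, HasDirDeriv F y (y - x) d →
    ‖F y - F x - d‖ ≤ C * ‖y - x‖ ^ 2

/-- The quadratic estimate has to be checked at the points of differentiability only. -/
theorem StronglySemismoothAt.of_differentiableAt {F : X → Y} {x : X}
    (hlip : ∃ K : NNReal, ∃ U ∈ 𝓝 x, LipschitzOnWith K F U)
    (hdir : DirectionallyDifferentiableAt F x)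
    (hquad : ∃ C : ℝ, ∀ᶠ y in 𝓝 x, DifferentiableAt ℝ F y →
      ‖F y - F x - fderiv ℝ F y (y - x)‖ ≤ C * ‖y - x‖ ^ 2) :
    StronglySemismoothAt F x := by
  refine ⟨hlip, hdir, ?_⟩
  obtain ⟨K, U, hU, hK⟩ := hlip
  obtain ⟨C, hC⟩ := hquad
  refine ⟨C, ?_⟩
  -- The estimate is needed on a neighbourhood of `x + h`, since the sequences defining the
  -- generalized Jacobian only converge to that point.
  have hev : ∀ᶠ y in 𝓝 x, ∀ᶠ z in 𝓝 y, z ∈ U ∧ (DifferentiableAt ℝ F z →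
      ‖F z - F x - fderiv ℝ F z (z - x)‖ ≤ C * ‖z - x‖ ^ 2) :=
    (Filter.Eventually.and hU hC).eventually_nhds
  have hadd : Tendsto (fun h : X => x + h) (𝓝 0) (𝓝 x) := by
    have : Continuous fun h : X => x + h := by fun_prop
    simpa using this.tendsto 0
  filter_upwards [hadd.eventually hev] with h hh V hV
  have hconv : Convex ℝ {V : X →L[ℝ] Y | ‖F (x + h) - F x - V h‖ ≤ C * ‖h‖ ^ 2} := by
    intro V hV W hW a b ha hb hab
    simp only [Set.mem_ofPred_eq] at hV hW ⊢
    have : F (x + h) - F x - (a • V + b • W) h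
        = a • (F (x + h) - F x - V h) + b • (F (x + h) - F x - W h) := by
      have hb' : b = 1 - a := by linarith
      subst hb'
      simp only [add_apply, smul_apply]
      module
    rw [this]
    calc _ ≤ a * ‖F (x + h) - F x - V h‖ + b * ‖F (x + h) - F x - W h‖ := by
          refine (norm_add_le _ _).trans ?_
          rw [norm_smul, norm_smul, Real.norm_of_nonneg ha, Real.norm_of_nonneg hb]
      _ ≤ a * (C * ‖h‖ ^ 2) + b * (C * ‖h‖ ^ 2) := by gcongr
      _ = C * ‖h‖ ^ 2 := by rw [← add_mul, hab, one_mul]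
  -- The estimate is convex in `V`, so it suffices to pass to the limit along each defining
  -- sequence.
  refine (convexHull_min ?_ hconv) hV
  rintro V ⟨u, hu, hux, huV⟩
  have hcont : ContinuousAt F (x + h) :=
    hK.continuousOn.continuousAt (hh.mono fun _ hz => hz.1)
  have h1 : Tendsto (fun k => u k - x) atTop (𝓝 h) := by
    simpa using hux.sub_const x
  have h2 : Tendsto (fun k => fderiv ℝ F (u k) (u k - x)) atTop (𝓝 (V h)) := by
    exact (isBoundedBilinearMap_apply (𝕜 := ℝ) (E := X) (F := Y)).continuous.tendsto (V, h) |>.comp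
      (huV.prodMk_nhds h1)
  have h3 : Tendsto (fun k => ‖F (u k) - F x - fderiv ℝ F (u k) (u k - x)‖) atTop
      (𝓝 ‖F (x + h) - F x - V h‖) :=
    (((hcont.tendsto.comp hux).sub_const (F x)).sub h2).norm
  refine le_of_tendsto_of_tendsto h3 ((h1.norm.pow 2).const_mul C) ?_
  filter_upwards [hux.eventually hh] with k hk
  exact hk.2 (hu k)

theorem RayStronglySemismoothAt.stronglySemismoothAt {F : X → Y} {x : X}
    (h : RayStronglySemismoothAt F x) : StronglySemismoothAt F x := by
  refine .of_differentiableAt h.lipschitz h.directional.self_of_nhds ?_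
  obtain ⟨C, hC⟩ := h.quadratic
  refine ⟨C, hC.mono fun y hy hd => hy _ (hd.hasFDerivAt.hasDirDeriv _)⟩

/-- Directional differentiability near `x`, not just at `x`, is what splits a derivative of the pair
into derivatives of the components. -/
theorem RayStronglySemismoothAt.prodMk {F : X → Y} {G : X → Z} {x : X}
    (hF : RayStronglySemismoothAt F x) (hG : RayStronglySemismoothAt G x) :
    RayStronglySemismoothAt (fun z => (F z, G z)) x := by
  obtain ⟨K, U, hU, hK⟩ := hF.lipschitz
  obtain ⟨L, V, hV, hL⟩ := hG.lipschitz
  obtain ⟨C, hC⟩ := hF.quadratic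
  obtain ⟨D, hD⟩ := hG.quadratic
  refine ⟨⟨max K L, U ∩ V, inter_mem hU hV,
    (hK.mono Set.inter_subset_left).prodMk (hL.mono Set.inter_subset_right)⟩, ?_, max C D, ?_⟩
  · filter_upwards [hF.directional, hG.directional] with y hy hy'
    rw [directionallyDifferentiableAt_iff] at *
    intro v
    obtain ⟨d, hd⟩ := hy v
    obtain ⟨d', hd'⟩ := hy' v
    exact ⟨_, hd.prodMk hd'⟩
  · filter_upwards [hC, hD, hF.directional, hG.directional] with y hy hy' hd hd' d hdd
    rw [directionallyDifferentiableAt_iff] at hd hd'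
    obtain ⟨d1, h1⟩ := hd (y - x)
    obtain ⟨d2, h2⟩ := hd' (y - x)
    obtain rfl := hdd.unique (h1.prodMk h2)
    rw [Prod.norm_def]
    refine max_le ?_ ?_
    · refine (hy _ h1).trans ?_
      gcongr
      exact le_max_left _ _
    · refine (hy' _ h2).trans ?_
      gcongr
      exact le_max_right _ _

theorem rayStronglySemismoothAt_id (x : X) : RayStronglySemismoothAt (fun z : X => z) x := by
  have hd : ∀ y v : X, HasDirDeriv (fun z : X => z) y v v := fun y v => by
    exact (hasFDerivAt_id (𝕜 := ℝ) y).hasDirDeriv v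
  refine ⟨⟨1, Set.univ, univ_mem, LipschitzWith.id.lipschitzOnWith⟩, ?_, 0, ?_⟩
  · exact .of_forall fun y => directionallyDifferentiableAt_iff.2 fun v => ⟨v, hd y v⟩
  · refine .of_forall fun y d h => ?_
    obtain rfl := h.unique (hd y _)
    simp

/-- A `C²` function satisfies a second order estimate with the derivative at the moving point. -/
theorem ContDiffAt.exists_norm_sub_sub_fderiv_le {φ : Y → Z} {a : Y} (hφ : ContDiffAt ℝ 2 φ a) :
    ∃ C : ℝ, 0 ≤ C ∧ ∀ᶠ b in 𝓝 a, DifferentiableAt ℝ φ b ∧ ‖fderiv ℝ φ b‖ ≤ C ∧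
      ‖φ b - φ a - fderiv ℝ φ b (b - a)‖ ≤ C * ‖b - a‖ ^ 2 := by
  have h1 : ContDiffAt ℝ 1 (fderiv ℝ φ) a := hφ.fderiv_right (by norm_num)
  obtain ⟨L, U, hU, hL⟩ := h1.exists_lipschitzOnWith
  have hdiff : ∀ᶠ b in 𝓝 a, DifferentiableAt ℝ φ b := by
    filter_upwards [hφ.eventually (by simp)] with b hb
    exact hb.differentiableAt (by simp)
  have hbd : ∀ᶠ b in 𝓝 a, ‖fderiv ℝ φ b‖ < ‖fderiv ℝ φ a‖ + 1 :=
    h1.continuousAt.norm.eventually_lt_const (by linarith)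
  obtain ⟨r, hr, hball⟩ := Metric.eventually_nhds_iff_ball.1 ((Filter.Eventually.and hU hdiff))
  refine ⟨max L (‖fderiv ℝ φ a‖ + 1), by positivity, ?_⟩
  filter_upwards [hdiff, hbd, Metric.ball_mem_nhds a hr] with b hb hb' hbr
  refine ⟨hb, hb'.le.trans (le_max_right _ _), ?_⟩
  have hseg : segment ℝ a b ⊆ Metric.ball a r :=
    (convex_ball a r).segment_subset (Metric.mem_ball_self hr) hbr
  -- On the segment, the derivative differs from the one at `b` by at most `L * ‖b - a‖`.
  have key := Convex.norm_image_sub_le_of_norm_fderiv_le' (𝕜 := ℝ) (f := φ)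
    (C := L * ‖b - a‖) (s := segment ℝ a b) (x := a) (y := b) (φ := fderiv ℝ φ b)
    (fun z hz => (hball z (hseg hz)).2) (fun z hz => ?_) (convex_segment a b)
    (left_mem_segment ℝ a b) (right_mem_segment ℝ a b)
  · calc _ ≤ L * ‖b - a‖ * ‖b - a‖ := key
      _ = L * ‖b - a‖ ^ 2 := by ring
      _ ≤ _ := by gcongr; exact le_max_left _ _
  · refine (hL.norm_sub_le (hball z (hseg hz)).1 (hball b hbr).1).trans ?_
    gcongr
    obtain ⟨s, t, hs, ht, hst, rfl⟩ := hz
    have : s • a + t • b - b = s • (a - b) := by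
      have : t = 1 - s := by linarith
      subst this; module
    rw [this, norm_smul, Real.norm_of_nonneg hs, norm_sub_rev]
    nlinarith [norm_nonneg (b - a)]

/-- The error splits into the second order error of `φ` between `G x` and `G y`, of size `D (K ‖y -
x‖)²`, and the derivative of `φ` at `G y` applied to the error of `G`. -/
theorem RayStronglySemismoothAt.contDiffAt_comp {G : X → Y} {φ : Y → Z} {x : X}
    (hφ : ContDiffAt ℝ 2 φ (G x)) (hG : RayStronglySemismoothAt G x) :
    RayStronglySemismoothAt (fun z => φ (G z)) x := by
  obtain ⟨K, U, hU, hK⟩ := hG.lipschitz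
  obtain ⟨L, V, hV, hL⟩ := (hφ.of_le (by norm_num : (1 : WithTop ℕ∞) ≤ 2)).exists_lipschitzOnWith
  obtain ⟨C, hC⟩ := hG.quadratic
  obtain ⟨D, hD0, hD⟩ := hφ.exists_norm_sub_sub_fderiv_le
  have hcont : Tendsto G (𝓝 x) (𝓝 (G x)) := (hK.continuousOn.continuousAt hU).tendsto
  refine ⟨⟨L * K, U ∩ G ⁻¹' V, inter_mem hU (hcont hV),
    hL.comp (hK.mono Set.inter_subset_left) fun z hz => hz.2⟩, ?_, D * K ^ 2 + D * C, ?_⟩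
  · filter_upwards [hG.directional, hcont.eventually hD] with y hy hy'
    rw [directionallyDifferentiableAt_iff] at *
    intro v
    obtain ⟨d, hd⟩ := hy v
    exact ⟨_, hd.comp_hasFDerivAt hy'.1.hasFDerivAt⟩
  · filter_upwards [hG.directional, hcont.eventually hD, hC, hU] with y hy hy' hyC hyU d hd
    rw [directionallyDifferentiableAt_iff] at hy
    obtain ⟨d', hd'⟩ := hy (y - x)
    obtain rfl := hd.unique (hd'.comp_hasFDerivAt hy'.1.hasFDerivAt)
    have e : φ (G y) - φ (G x) - fderiv ℝ φ (G y) d'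
        = (φ (G y) - φ (G x) - fderiv ℝ φ (G y) (G y - G x))
          + fderiv ℝ φ (G y) (G y - G x - d') := by
      rw [map_sub _ (G y - G x)]; abel
    rw [e]
    have h1 : ‖G y - G x‖ ≤ K * ‖y - x‖ := hK.norm_sub_le hyU (mem_of_mem_nhds hU)
    calc _ ≤ D * ‖G y - G x‖ ^ 2 + ‖fderiv ℝ φ (G y)‖ * ‖G y - G x - d'‖ :=
          (norm_add_le _ _).trans (add_le_add hy'.2.2 (ContinuousLinearMap.le_opNorm _ _))
      _ ≤ D * (K * ‖y - x‖) ^ 2 + D * (C * ‖y - x‖ ^ 2) := by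
          gcongr
          · exact hy'.2.1
          · exact hyC _ hd'
      _ = _ := by ring

theorem ContDiffAt.rayStronglySemismoothAt {φ : X → Y} {x : X} (hφ : ContDiffAt ℝ 2 φ x) :
    RayStronglySemismoothAt φ x :=
  (rayStronglySemismoothAt_id x).contDiffAt_comp hφ

theorem RayStronglySemismoothAt.smul {a : X → ℝ} {k : X → Y} {x : X}
    (ha : RayStronglySemismoothAt a x) (hk : RayStronglySemismoothAt k x) :
    RayStronglySemismoothAt (fun z => a z • k z) x :=
  (ha.prodMk hk).contDiffAt_comp (φ := fun q : ℝ × Y => q.1 • q.2)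
    (contDiff_fst.smul contDiff_snd).contDiffAt

theorem RayStronglySemismoothAt.add {F G : X → Y} {x : X}
    (hF : RayStronglySemismoothAt F x) (hG : RayStronglySemismoothAt G x) :
    RayStronglySemismoothAt (fun z => F z + G z) x :=
  (hF.prodMk hG).contDiffAt_comp (φ := fun q : Y × Y => q.1 + q.2)
    (contDiff_fst.add contDiff_snd).contDiffAt

/-- The norm of a linear map is strongly semismooth at the points of the kernel. -/
theorem rayStronglySemismoothAt_of_map_eq_zero (P : X →L[ℝ] Y) {ρ : X → ℝ}
    (hρ : ∀ y, ρ y = ‖P y‖)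
    (hdir : ∀ y, ρ y ≠ 0 → DirectionallyDifferentiableAt ρ y) {x : X} (hx : ρ x = 0) :
    RayStronglySemismoothAt ρ x := by
  have hP0 : ∀ y, ρ y = 0 → P y = 0 := fun y hy => by simpa [hρ] using hy
  refine ⟨⟨‖P‖₊, Set.univ, univ_mem, ?_⟩, .of_forall fun y => ?_, 0, .of_forall fun y d hd => ?_⟩
  · refine LipschitzOnWith.of_dist_le_mul fun y _ z _ => ?_
    rw [hρ, hρ, dist_eq_norm, dist_eq_norm]
    refine (abs_norm_sub_norm_le _ _).trans ?_
    rw [← map_sub]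
    exact P.le_opNorm _
  · by_cases hy : ρ y = 0
    · rw [directionallyDifferentiableAt_iff]
      refine fun v => ⟨ρ v, ?_⟩
      have h1 : HasDerivWithinAt (fun t : ℝ => t * ρ v) (ρ v) (Set.Ioi 0) 0 := by
        simpa using ((hasDerivAt_id (0 : ℝ)).mul_const (ρ v)).hasDerivWithinAt
      refine h1.congr (fun t ht => ?_) (by simp [hy])
      rw [hρ, map_add, hP0 y hy, zero_add, map_smul, norm_smul, Real.norm_of_nonneg (le_of_lt ht),
        ← hρ]
    · exact hdir y hy
  -- As `P x = 0`, `ρ` is linear along the ray from `x` through `y`, so the error is exactly zero.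
  · have h1 : HasDerivWithinAt (fun t : ℝ => (1 + t) * ρ y) (ρ y) (Set.Ioi 0) 0 := by
      simpa using (((hasDerivAt_id (0 : ℝ)).const_add 1).mul_const (ρ y)).hasDerivWithinAt
    have h2 : HasDirDeriv ρ y (y - x) (ρ y) := by
      refine h1.congr (fun t ht => ?_) (by simp)
      have ht : (0 : ℝ) < t := ht
      rw [hρ, map_add, map_smul, map_sub, hP0 x hx, sub_zero, hρ y,
        show P y + t • P y = (1 + t) • P y by module, norm_smul,
        Real.norm_of_nonneg (by positivity)]
    obtain rfl := hd.unique h2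
    simp [hx]

/-- The product of a strongly semismooth function vanishing on the kernel of a projection `P` and
of a bounded function that is constant along the rays emanating from the points of this kernel. -/
theorem RayStronglySemismoothAt.smul_of_const_on_rays (P : X →L[ℝ] X) (hP : ∀ y, P (P y) = P y)
    {a : X → ℝ} {k : X → Y} (ha : ∀ y, RayStronglySemismoothAt a y)
    (ha0 : ∀ y, P y = 0 → a y = 0)
    {B M : ℝ} (hB : ∀ y, P y ≠ 0 → ‖k y‖ ≤ B)
    (hM : ∀ y z, P y ≠ 0 → P z ≠ 0 → ‖P y‖ * ‖k y - k z‖ ≤ M * ‖y - z‖)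
    (hray : ∀ x v, P x = 0 → ∀ t : ℝ, 0 < t → k (x + t • v) = k v)
    (hk : ∀ y, P y ≠ 0 → RayStronglySemismoothAt k y) (x : X) :
    RayStronglySemismoothAt (fun z => a z • k z) x := by
  by_cases hx : P x ≠ 0
  · exact (ha x).smul (hk x hx)
  rw [not_not] at hx
  have haxz : a x = 0 := ha0 x hx
  -- On the open ray `k` equals `k v`; at its origin `a` vanishes, so the value of `k` there is
  -- irrelevant.
  have hdirzero : ∀ y v, P y = 0 → ∀ d, HasDirDeriv a y v d →
      HasDirDeriv (fun z => a z • k z) y v (d • k v) := by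
    intro y v hy d hd
    have h1 := HasDerivWithinAt.smul_const hd (k v)
    refine h1.congr (fun t ht => ?_) (by simp [ha0 y hy])
    simp only [hray y v hy t ht]
  refine ⟨?_, .of_forall fun y => ?_, ?_⟩
  · obtain ⟨K, U, hU, hK⟩ := (ha x).lipschitz
    obtain ⟨r, hr, hball⟩ := Metric.mem_nhds_iff.1 hU
    have hbd : ∀ᶠ y in 𝓝 x, y ∈ U ∧ y - P y ∈ U := by
      have hc : Continuous fun y => y - P y := by fun_prop
      have : Tendsto (fun y => y - P y) (𝓝 x) (𝓝 x) := by
        simpa [hx] using hc.tendsto x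
      exact Filter.Eventually.and hU (this hU)
    -- The point `y - P y` lies in the kernel, at distance `‖P y‖` from `y`.
    have hasmall : ∀ y, y ∈ U ∧ y - P y ∈ U → ‖a y‖ ≤ K * ‖P y‖ := by
      intro y hy
      have h1 := hK.norm_sub_le hy.1 hy.2
      rwa [ha0 (y - P y) (by rw [map_sub, hP, sub_self]), sub_zero, sub_sub_cancel] at h1
    -- The term `K * ‖P‖ * |B|` is slack. If neither point is in the kernel, `‖a y‖ ≤ K ‖P y‖`
    -- supplies the weight required by `hM`.
    have hmain : ∀ y z, (y ∈ U ∧ y - P y ∈ U) → (z ∈ U ∧ z - P z ∈ U) →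
        ‖a y • k y - a z • k z‖ ≤ (K * |B| + K * |M| + K * ‖P‖ * |B|) * ‖y - z‖ := by
      intro y z hy hz
      have hKyz := hK.norm_sub_le hy.1 hz.1
      by_cases hPz : P z = 0
      · by_cases hPy : P y = 0
        · rw [ha0 y hPy, ha0 z hPz, zero_smul, zero_smul, sub_zero, norm_zero]
          positivity
        · rw [ha0 z hPz, zero_smul, sub_zero, norm_smul]
          rw [ha0 z hPz, sub_zero] at hKyz
          calc ‖a y‖ * ‖k y‖ ≤ (K * ‖y - z‖) * |B| := by
                gcongr
                exact (hB y hPy).trans (le_abs_self B)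
            _ = (K * |B| + 0 + 0) * ‖y - z‖ := by ring
            _ ≤ _ := by gcongr <;> positivity
      · by_cases hPy : P y = 0
        · rw [ha0 y hPy, zero_smul, zero_sub, norm_neg, norm_smul]
          rw [ha0 y hPy, zero_sub, norm_neg] at hKyz
          calc ‖a z‖ * ‖k z‖ ≤ (K * ‖y - z‖) * |B| := by
                gcongr
                exact (hB z hPz).trans (le_abs_self B)
            _ = (K * |B| + 0 + 0) * ‖y - z‖ := by ring
            _ ≤ _ := by gcongr <;> positivity
        · have e : a y • k y - a z • k z = (a y - a z) • k z + a y • (k y - k z) := by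
            module
          rw [e]
          calc _ ≤ ‖a y - a z‖ * ‖k z‖ + ‖a y‖ * ‖k y - k z‖ := by
                refine (norm_add_le _ _).trans ?_
                rw [norm_smul, norm_smul]
            _ ≤ (K * ‖y - z‖) * |B| + (K * ‖P y‖) * ‖k y - k z‖ := by
                gcongr
                · exact (hB z hPz).trans (le_abs_self B)
                · exact hasmall y hy
            _ = (K * ‖y - z‖) * |B| + K * (‖P y‖ * ‖k y - k z‖) := by ring
            _ ≤ (K * ‖y - z‖) * |B| + K * (|M| * ‖y - z‖) := by
                refine add_le_add_right (mul_le_mul_of_nonneg_left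
                  ((hM y z hPy hPz).trans ?_) K.coe_nonneg) _
                gcongr
                exact le_abs_self M
            _ = (K * |B| + K * |M| + 0) * ‖y - z‖ := by ring
            _ ≤ _ := by gcongr; positivity
    refine ⟨(K * |B| + K * |M| + K * ‖P‖ * |B|).toNNReal, _, hbd,
      LipschitzOnWith.of_dist_le_mul fun y hy z hz => ?_⟩
    rw [dist_eq_norm, dist_eq_norm, Real.coe_toNNReal _ (by positivity)]
    exact hmain y z hy hz
  · by_cases hy : P y = 0
    · have := (ha y).directional.self_of_nhds
      rw [directionallyDifferentiableAt_iff] at *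
      intro v
      obtain ⟨d, hd⟩ := this v
      exact ⟨_, hdirzero y v hy d hd⟩
    · exact ((ha y).smul (hk y hy)).directional.self_of_nhds
  · obtain ⟨C, hC⟩ := (ha x).quadratic
    refine ⟨|C| * |B|, ?_⟩
    filter_upwards [hC] with y hy d hd
    have := (ha y).directional.self_of_nhds
    rw [directionallyDifferentiableAt_iff] at this
    obtain ⟨d', hd'⟩ := this (y - x)
    by_cases hPy : P y = 0
    · have hz : HasDirDeriv (fun z => a z • k z) y (y - x) 0 := by
        have h0 : HasDirDeriv (fun _ : X => (0 : Y)) y (y - x) 0 := by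
          simpa using (hasFDerivAt_const (0 : Y) y).hasDirDeriv (y - x)
        refine h0.congr_pos (by simp [ha0 y hPy]) fun t ht => ?_
        simp [ha0 (y + t • (y - x)) (by simp [hPy, hx])]
      obtain rfl := hd.unique hz
      simp only [ha0 y hPy, haxz, zero_smul, sub_zero, norm_zero]
      positivity
    -- The points `y + t • (y - x)` stay on the ray from `x` through `y`, where `k` is constant;
    -- only `a` is differentiated.
    · have hky : ∀ t : ℝ, 0 < t → k (y + t • (y - x)) = k (y - x) := by
        intro t ht
        rw [show y + t • (y - x) = x + (1 + t) • (y - x) by module]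
        exact hray x _ hx _ (by positivity)
      have hky0 : k y = k (y - x) := by
        simpa using hray x (y - x) hx 1 one_pos
      have hd2 : HasDirDeriv (fun z => a z • k z) y (y - x) (d' • k y) := by
        have h1 := HasDerivWithinAt.smul_const hd' (k y)
        refine h1.congr (fun t ht => ?_) (by simp)
        simp only [hky t ht, hky0]
      obtain rfl := hd.unique hd2
      rw [haxz, zero_smul, sub_zero, ← sub_smul, norm_smul]
      have h1 := hy d' hd'
      rw [haxz, sub_zero] at h1
      calc _ ≤ (C * ‖y - x‖ ^ 2) * |B| :=
            mul_le_mul h1 ((hB y hPy).trans (le_abs_self B)) (norm_nonneg _)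
              ((norm_nonneg _).trans h1)
        _ ≤ (|C| * ‖y - x‖ ^ 2) * |B| := by
            gcongr
            exact le_abs_self C
        _ = _ := by ring

end SemismoothCalculus

/-! ### From Clarke's Jacobian to derivatives along rays -/

section MeanValue

variable {X Y : Type*} [NormedAddCommGroup X] [NormedSpace ℝ X] [FiniteDimensional ℝ X]
  [NormedAddCommGroup Y] [NormedSpace ℝ Y] [FiniteDimensional ℝ Y]

open MeasureTheory in
/-- A mean value inequality for Lipschitz functions whose hypothesis concerns the points of
differentiability only. -/
theorem LipschitzWith.norm_sub_sub_smul_le {F : X → Y} {K : NNReal} (hF : LipschitzWith K F)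
    {x y v : X} {w : Y} {r ε T : ℝ} (hT : 0 ≤ T)
    (hseg : ∀ t ∈ Set.Icc 0 T, y + t • v ∈ Metric.ball x r)
    (hder : ∀ z ∈ Metric.ball x r, DifferentiableAt ℝ F z → ‖fderiv ℝ F z v - w‖ ≤ ε) :
    ‖F (y + T • v) - F y - T • w‖ ≤ T * ε := by
  let _ : MeasurableSpace X := borel X
  have : BorelSpace X := ⟨rfl⟩
  let _ : MeasurableSpace Y := borel Y
  have : BorelSpace Y := ⟨rfl⟩
  set μ : Measure X := Measure.addHaar
  -- a uniform distance of the segment from the boundary of the ball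
  obtain ⟨δ₀, hδ₀, hδ₀'⟩ : ∃ δ₀ > 0, ∀ t ∈ Set.Icc 0 T, ∀ u ∈ Metric.ball (0 : X) δ₀,
      y + t • v + u ∈ Metric.ball x r := by
    have hcpt : IsCompact ((fun t : ℝ => y + t • v) '' Set.Icc 0 T) :=
      isCompact_Icc.image (by fun_prop)
    obtain ⟨δ, hδ, hsub⟩ := hcpt.exists_thickening_subset_open Metric.isOpen_ball
      (by rintro _ ⟨t, ht, rfl⟩; exact hseg t ht)
    refine ⟨δ, hδ, fun t ht u hu => hsub ?_⟩
    rw [Metric.mem_thickening_iff]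
    exact ⟨_, ⟨t, ht, rfl⟩, by simpa [dist_eq_norm] using hu⟩
  -- The segment may miss all points of differentiability, so `F` is averaged over translates by a
  -- ball of radius `δ`. Undoing the average costs `K * δ` at each endpoint.
  have hmain : ∀ δ ∈ Set.Ioo 0 δ₀,
      ‖F (y + T • v) - F y - T • w‖ ≤ T * ε + 2 * K * δ := by
    intro δ hδ
    set B := Metric.ball (0 : X) δ
    have hBfin : μ B < ⊤ := measure_ball_lt_top
    have hBpos : 0 < μ.real B :=
      ENNReal.toReal_pos (Metric.measure_ball_pos μ 0 hδ.1).ne' hBfin.ne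
    have : IsFiniteMeasure (μ.restrict B) := ⟨by simpa using hBfin⟩
    have hcontF : Continuous F := hF.continuous
    have hint : ∀ t : ℝ, IntegrableOn (fun u => F (y + t • v + u)) B μ := by
      intro t
      have hc : Continuous fun u => F (y + t • v + u) := by fun_prop
      exact (hc.continuousOn.integrableOn_compact (isCompact_closedBall (0 : X) δ)).mono_set
        Metric.ball_subset_closedBall
    -- Rademacher's theorem and the dominating constant `K * ‖v‖` allow differentiation under the
    -- integral.
    have hderiv : ∀ t : ℝ,
        IntegrableOn (fun u => fderiv ℝ F (y + t • v + u) v) B μ ∧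
        HasDerivAt (fun t : ℝ => ∫ u in B, F (y + t • v + u) ∂μ)
          (∫ u in B, fderiv ℝ F (y + t • v + u) v ∂μ) t := by
      intro t
      refine hasDerivAt_integral_of_dominated_loc_of_lip (s := Set.univ)
        (bound := fun _ => K * ‖v‖) univ_mem
        (.of_forall fun s => (hint s).aestronglyMeasurable) (hint t) ?_ ?_ ?_ ?_
      · have : Measurable fun u => fderiv ℝ F (y + t • v + u) v :=
          (measurable_fderiv_apply_const ℝ F v).comp (measurable_const_add _)
        exact this.aestronglyMeasurable
      · refine .of_forall fun u => LipschitzOnWith.of_dist_le_mul fun s _ s' _ => ?_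
        refine (hF.dist_le_mul _ _).trans (le_of_eq ?_)
        rw [Real.coe_nnabs, abs_of_nonneg (by positivity), dist_eq_norm, dist_eq_norm,
          show y + s • v + u - (y + s' • v + u) = (s - s') • v by module, norm_smul]
        ring
      · exact integrable_const _
      · refine ae_restrict_of_ae ?_
        have hae : ∀ᵐ u ∂μ, DifferentiableAt ℝ F (y + t • v + u) :=
          (measurePreserving_add_left μ (y + t • v)).quasiMeasurePreserving.ae
            hF.ae_differentiableAt
        filter_upwards [hae] with u hu
        have h1 : HasDerivAt (fun s : ℝ => y + s • v + u) v t := by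
          simpa using (((hasDerivAt_id t).smul_const v).const_add y).add_const u
        exact hu.hasFDerivAt.comp_hasDerivAt t h1
    have hmv := norm_image_sub_le_of_norm_deriv_le_segment' (a := 0) (b := T)
      (f := fun t : ℝ => (∫ u in B, F (y + t • v + u) ∂μ) - t • (μ.real B • w))
      (f' := fun t => (∫ u in B, fderiv ℝ F (y + t • v + u) v ∂μ) - μ.real B • w)
      (C := ε * μ.real B)
      (fun t _ => by
        refine ((hderiv t).2.sub ?_).hasDerivWithinAt
        simpa using (hasDerivAt_id t).smul_const (μ.real B • w))
      (fun t ht => by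
        have e : (∫ u in B, fderiv ℝ F (y + t • v + u) v ∂μ) - μ.real B • w
            = ∫ u in B, (fderiv ℝ F (y + t • v + u) v - w) ∂μ := by
          rw [integral_sub (hderiv t).1 (integrable_const _)]
          simp
        rw [e]
        refine norm_setIntegral_le_of_norm_le_const_ae' hBfin ?_
        have hae : ∀ᵐ u ∂μ, DifferentiableAt ℝ F (y + t • v + u) :=
          (measurePreserving_add_left μ (y + t • v)).quasiMeasurePreserving.ae
            hF.ae_differentiableAt
        filter_upwards [hae] with u hu huB
        exact hder _ (hδ₀' t ⟨ht.1, ht.2.le⟩ u (Metric.ball_subset_ball hδ.2.le huB)) hu)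
      T ⟨hT, le_rfl⟩
    have hint0 : IntegrableOn (fun u => F (y + u)) B μ := by simpa using hint 0
    have hdiff : ‖(∫ u in B, (F (y + T • v + u) - F (y + u)) ∂μ)
        - μ.real B • (F (y + T • v) - F y)‖ ≤ 2 * K * δ * μ.real B := by
      have e : (∫ u in B, (F (y + T • v + u) - F (y + u)) ∂μ)
          - μ.real B • (F (y + T • v) - F y)
          = ∫ u in B, ((F (y + T • v + u) - F (y + u)) - (F (y + T • v) - F y)) ∂μ := by
        have hs : IntegrableOn (fun u => F (y + T • v + u) - F (y + u)) B μ := (hint T).sub hint0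
        rw [integral_sub hs (integrable_const _)]
        simp
      rw [e]
      refine norm_setIntegral_le_of_norm_le_const hBfin fun u hu => ?_
      have hu' : ‖u‖ ≤ δ := by simpa using (Metric.mem_ball.1 hu).le
      have h1 : ‖F (y + T • v + u) - F (y + T • v)‖ ≤ K * δ := by
        refine (hF.norm_sub_le _ _).trans ?_
        gcongr
        simpa using hu'
      have h2 : ‖F (y + u) - F y‖ ≤ K * δ := by
        refine (hF.norm_sub_le _ _).trans ?_
        gcongr
        simpa using hu'
      calc _ = ‖(F (y + T • v + u) - F (y + T • v)) - (F (y + u) - F y)‖ := by congr 1; abel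
        _ ≤ K * δ + K * δ := (_root_.norm_sub_le _ _).trans (add_le_add h1 h2)
        _ = 2 * K * δ := by ring
    have e : μ.real B • (F (y + T • v) - F y - T • w)
        = ((∫ u in B, F (y + T • v + u) ∂μ) - T • (μ.real B • w)
            - ((∫ u in B, F (y + (0 : ℝ) • v + u) ∂μ) - (0 : ℝ) • (μ.real B • w)))
          - ((∫ u in B, (F (y + T • v + u) - F (y + u)) ∂μ)
            - μ.real B • (F (y + T • v) - F y)) := by
      rw [integral_sub (hint T) hint0]
      simp only [zero_smul, add_zero, sub_zero]
      module
    have h3 : μ.real B * ‖F (y + T • v) - F y - T • w‖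
        ≤ μ.real B * (T * ε + 2 * K * δ) := by
      rw [← Real.norm_of_nonneg hBpos.le, ← norm_smul, Real.norm_of_nonneg hBpos.le, e]
      refine (_root_.norm_sub_le _ _).trans ((add_le_add hmv hdiff).trans (le_of_eq ?_))
      ring
    exact le_of_mul_le_mul_left h3 hBpos
  have hlim : Tendsto (fun δ : ℝ => T * ε + 2 * K * δ) (𝓝[>] 0) (𝓝 (T * ε)) := by
    have hc : Continuous fun δ : ℝ => T * ε + 2 * K * δ := by fun_prop
    simpa using (hc.tendsto 0).mono_left nhdsWithin_le_nhds
  refine ge_of_tendsto hlim ?_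
  filter_upwards [Ioo_mem_nhdsGT hδ₀] with δ hδ using hmain δ hδ

/-- In finite dimension, strong semismoothness yields the estimate for one-sided derivatives along
rays, also where the function is not differentiable. -/
theorem StronglySemismoothAt.rayStronglySemismoothAt {F : X → Y} {x : X}
    (h : StronglySemismoothAt F x) (hdir : ∀ᶠ y in 𝓝 x, DirectionallyDifferentiableAt F y) :
    RayStronglySemismoothAt F x := by
  refine ⟨h.lipschitz, hdir, ?_⟩
  obtain ⟨K₀, U, hU, hK₀⟩ := h.lipschitz
  obtain ⟨C₀, hC₀⟩ := h.quadratic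
  -- A derivative at `z` belongs to the generalized Jacobian at `z`, by the constant sequence.
  obtain ⟨C, hC, hC0⟩ : ∃ C, (∀ᶠ z in 𝓝 x, DifferentiableAt ℝ F z →
      ‖F z - F x - fderiv ℝ F z (z - x)‖ ≤ C * ‖z - x‖ ^ 2) ∧ 0 ≤ C := by
    refine ⟨|C₀|, ?_, abs_nonneg _⟩
    have hsub : Tendsto (fun z : X => z - x) (𝓝 x) (𝓝 0) := by
      have hc : Continuous fun z : X => z - x := by fun_prop
      simpa using hc.tendsto x
    filter_upwards [hsub.eventually hC₀] with z hz hd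
    refine (le_trans ?_ (hz (fderiv ℝ F z) ?_)).trans
      (mul_le_mul_of_nonneg_right (le_abs_self C₀) (by positivity))
    · rw [add_sub_cancel]
    · rw [add_sub_cancel]
      exact subset_convexHull ℝ _ ⟨fun _ => z, fun _ => hd, tendsto_const_nhds, tendsto_const_nhds⟩
  obtain ⟨r, hr, hball⟩ := Metric.eventually_nhds_iff_ball.1 (Filter.Eventually.and hU hC)
  -- The mean value inequality requires a globally Lipschitz function. The extension agrees with `F`
  -- on an open ball, hence has the same derivatives there.
  obtain ⟨G, hG, hFG⟩ := (hK₀.mono fun z hz => (hball z hz).1).extend_finite_dimension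
  set K := lipschitzExtensionConstant Y * K₀
  have hev : ∀ z ∈ Metric.ball x r, F =ᶠ[𝓝 z] G := fun z hz =>
    hFG.eventuallyEq_of_mem (Metric.isOpen_ball.mem_nhds hz)
  refine ⟨C, ?_⟩
  filter_upwards [Metric.ball_mem_nhds x hr] with y hy d hd
  set v := y - x
  set w := F y - F x
  rw [← norm_neg, neg_sub]
  -- Replacing `z` by `y`, for `‖z - y‖ ≤ η`, costs `K * η` in the value and `K * η` in the
  -- derivative term. The mean value inequality carries the bound to difference quotients at `y`;
  -- then `η → 0`.
  have hη : ∀ᶠ η in 𝓝[>] (0 : ℝ), ‖d - w‖ ≤ C * (‖v‖ + η) ^ 2 + 2 * K * η := by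
    obtain ⟨η₀, hη₀, hη₀'⟩ := Metric.isOpen_ball.mem_nhds hy |> Metric.mem_nhds_iff.1
    filter_upwards [Ioo_mem_nhdsGT hη₀] with η hη
    have hsub : Metric.ball y η ⊆ Metric.ball x r :=
      (Metric.ball_subset_ball hη.2.le).trans hη₀'
    have hder : ∀ z ∈ Metric.ball y η, DifferentiableAt ℝ G z →
        ‖fderiv ℝ G z v - w‖ ≤ C * (‖v‖ + η) ^ 2 + 2 * K * η := by
      intro z hz hdz
      have hzF : DifferentiableAt ℝ F z := (hev z (hsub hz)).differentiableAt_iff.2 hdz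
      have h1 := (hball z (hsub hz)).2 hzF
      rw [(hev z (hsub hz)).fderiv_eq] at h1
      have hzy : ‖z - y‖ ≤ η := by
        rw [← dist_eq_norm]; exact (Metric.mem_ball.1 hz).le
      have hzx : ‖z - x‖ ≤ ‖v‖ + η := by
        have : z - x = v + (z - y) := by simp [v]
        rw [this]
        exact (norm_add_le _ _).trans (by gcongr)
      have h2 : ‖F z - F y‖ ≤ K * η := by
        rw [hFG (hsub hz), hFG hy]
        refine (hG.norm_sub_le _ _).trans ?_
        gcongr
      have h3 : ‖fderiv ℝ G z (z - y)‖ ≤ K * η := by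
        refine (ContinuousLinearMap.le_opNorm _ _).trans ?_
        gcongr
        exact norm_fderiv_le_of_lipschitz ℝ hG
      have e : fderiv ℝ G z v - w = -(F z - F x - fderiv ℝ G z (z - x)) + (F z - F y)
          - fderiv ℝ G z (z - y) := by
        have : z - x = v + (z - y) := by simp [v]
        rw [this, map_add]
        simp only [w]
        abel
      rw [e]
      calc _ ≤ ‖F z - F x - fderiv ℝ G z (z - x)‖ + ‖F z - F y‖
            + ‖fderiv ℝ G z (z - y)‖ := by
            refine (_root_.norm_sub_le _ _).trans ?_
            gcongr
            refine (norm_add_le _ _).trans ?_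
            rw [norm_neg]
        _ ≤ C * (‖v‖ + η) ^ 2 + K * η + K * η := by
            gcongr
            refine h1.trans ?_
            gcongr
        _ = _ := by ring
    have hsmall : ∀ᶠ T in 𝓝[>] (0 : ℝ), T * ‖v‖ < η := by
      have hc : Continuous fun T : ℝ => T * ‖v‖ := by fun_prop
      have : Tendsto (fun T : ℝ => T * ‖v‖) (𝓝[>] 0) (𝓝 0) := by
        simpa using (hc.tendsto 0).mono_left nhdsWithin_le_nhds
      exact this.eventually_lt_const hη.1
    refine le_of_tendsto ((hasDirDeriv_iff_tendsto.1 hd).sub_const w).norm ?_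
    filter_upwards [hsmall, self_mem_nhdsWithin] with T hT hT0
    have hT0 : 0 < T := hT0
    have hseg : ∀ t ∈ Set.Icc 0 T, y + t • v ∈ Metric.ball y η := by
      intro t ht
      rw [Metric.mem_ball, dist_eq_norm, add_sub_cancel_left, norm_smul,
        Real.norm_of_nonneg ht.1]
      exact (mul_le_mul_of_nonneg_right ht.2 (norm_nonneg v)).trans_lt hT
    have h1 := hG.norm_sub_sub_smul_le hT0.le hseg hder
    rw [← hFG hy, ← hFG (hsub (hseg T ⟨hT0.le, le_rfl⟩))] at h1
    have e : T⁻¹ • (F (y + T • v) - F y) - w = T⁻¹ • (F (y + T • v) - F y - T • w) := by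
      rw [smul_sub _ _ (T • w), inv_smul_smul₀ hT0.ne']
    rw [e, norm_smul, norm_inv, Real.norm_of_nonneg hT0.le, inv_mul_le_iff₀ hT0]
    exact h1
  have hlim : Tendsto (fun η : ℝ => C * (‖v‖ + η) ^ 2 + 2 * K * η) (𝓝[>] 0)
      (𝓝 (C * ‖v‖ ^ 2)) := by
    have hc : Continuous fun η : ℝ => C * (‖v‖ + η) ^ 2 + 2 * K * η := by fun_prop
    simpa using (hc.tendsto 0).mono_left nhdsWithin_le_nhds
  exact ge_of_tendsto hlim hη

theorem StronglySemismooth.rayStronglySemismoothAt {F : X → Y} (h : StronglySemismooth F) (x : X) :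
    RayStronglySemismoothAt F x :=
  (h x).rayStronglySemismoothAt (.of_forall fun y => (h y).directional)

end MeanValue

/-! ### Strong semismoothness of the maximal eigenvalue -/

section MaximalEigenvalue

variable {E : Type*} [NormedAddCommGroup E] [InnerProductSpace ℝ E]

/-- On a complement of its kernel, a symmetric operator is bounded from below. -/
theorem LinearMap.IsSymmetric.exists_inner_le_mul_norm_sq [FiniteDimensional ℝ E]
    {M : E →ₗ[ℝ] E} (hM : M.IsSymmetric) :
    ∃ C : ℝ, ∀ v, inner ℝ (M v) v ≤ C * ‖M v‖ ^ 2 := by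
  -- A generalized inverse `N` with `M N M = M` gives `⟪M v, v⟫ = ⟪N M v, M v⟫` by symmetry, so `C =
  -- ‖N‖` works.
  obtain ⟨g, hg⟩ := M.rangeRestrict.exists_rightInverse_of_surjective M.range_rangeRestrict
  obtain ⟨N, hN⟩ := g.exists_extend
  have hMNM : ∀ v, M (N (M v)) = M v := by
    intro v
    have h1 : N (M v) = g (M.rangeRestrict v) := LinearMap.congr_fun hN (M.rangeRestrict v)
    have h2 := LinearMap.congr_fun hg (M.rangeRestrict v)
    rw [h1]
    exact congrArg Subtype.val h2
  refine ⟨‖LinearMap.toContinuousLinearMap N‖, fun v => ?_⟩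
  calc inner ℝ (M v) v = inner ℝ (N (M v)) (M v) := by
        conv_lhs => rw [← hMNM v]
        exact hM _ _
    _ ≤ ‖N (M v)‖ * ‖M v‖ := real_inner_le_norm _ _
    _ ≤ (‖LinearMap.toContinuousLinearMap N‖ * ‖M v‖) * ‖M v‖ := by
        gcongr
        exact (LinearMap.toContinuousLinearMap N).le_opNorm (M v)
    _ = _ := by ring

/-- `l` is the maximum of the quadratic form of `A` on the unit sphere. -/
def IsMaxRayleigh (A : E →L[ℝ] E) (l : ℝ) : Prop :=
  (∀ v, ‖v‖ = 1 → inner ℝ (A v) v ≤ l) ∧ ∃ v, ‖v‖ = 1 ∧ inner ℝ (A v) v = l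

theorem exists_isMaxRayleigh [FiniteDimensional ℝ E] [Nontrivial E] (A : E →L[ℝ] E) :
    ∃ l, IsMaxRayleigh A l := by
  have hne : (Metric.sphere (0 : E) 1).Nonempty := NormedSpace.sphere_nonempty.2 zero_le_one
  obtain ⟨v, hv, hmax⟩ := (isCompact_sphere (0 : E) 1).exists_isMaxOn hne
    (f := fun v => inner ℝ (A v) v) (by fun_prop)
  exact ⟨_, fun w hw => hmax (by simpa using hw), v, by simpa using hv, rfl⟩

theorem IsMaxRayleigh.unique {A : E →L[ℝ] E} {l l' : ℝ} (h : IsMaxRayleigh A l) (h' : IsMaxRayleigh A l') : l = l' := by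
  obtain ⟨v, hv, hvl⟩ := h.2
  obtain ⟨w, hw, hwl⟩ := h'.2
  exact le_antisymm (hvl ▸ h'.1 v hv) (hwl ▸ h.1 w hw)

theorem IsMaxRayleigh.inner_le {A : E →L[ℝ] E} {l : ℝ} (h : IsMaxRayleigh A l) (v : E) :
    inner ℝ (A v) v ≤ l * ‖v‖ ^ 2 := by
  by_cases hv : v = 0
  · simp [hv]
  have h1 := h.1 (‖v‖⁻¹ • v) (by simp [norm_smul, hv])
  rw [map_smul, real_inner_smul_left, real_inner_smul_right] at h1
  have hv' : 0 < ‖v‖ := norm_pos_iff.2 hv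
  calc inner ℝ (A v) v = (‖v‖⁻¹ * (‖v‖⁻¹ * inner ℝ (A v) v)) * ‖v‖ ^ 2 := by field_simp
    _ ≤ l * ‖v‖ ^ 2 := by gcongr

theorem IsMaxRayleigh.apply_eq [FiniteDimensional ℝ E] {A : E →L[ℝ] E} {l : ℝ}
    (h : IsMaxRayleigh A l)
    (hA : IsSelfAdjoint A) {v : E} (hv : ‖v‖ = 1) (hvl : inner ℝ (A v) v = l) : A v = l • v := by
  have hmax : IsMaxOn A.reApplyInnerSelf (Metric.sphere 0 ‖v‖) v := by
    intro w hw
    have hw' : ‖w‖ = 1 := by simpa [hv] using hw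
    simpa [ContinuousLinearMap.reApplyInnerSelf_apply, hvl] using h.1 w hw'
  have := hA.eq_smul_self_of_isLocalExtrOn_real (Or.inr hmax.localize)
  rw [this]
  simp [ContinuousLinearMap.rayleighQuotient, ContinuousLinearMap.reApplyInnerSelf_apply, hv, hvl]

variable {X : Type*} [NormedAddCommGroup X] [NormedSpace ℝ X]

/-- A maximizing vector for `x` is a test vector for `y`, and conversely. -/
theorem abs_sub_le_of_isMaxRayleigh {T : X →L[ℝ] (E →L[ℝ] E)} {l : X → ℝ}
    (hl : ∀ x, IsMaxRayleigh (T x) (l x)) (x y : X) : |l x - l y| ≤ ‖T‖ * ‖x - y‖ := by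
  have hinner : ∀ x (v : E), ‖v‖ = 1 → |inner ℝ (T x v) v| ≤ ‖T‖ * ‖x‖ := by
    intro x v hv
    calc _ ≤ ‖T x v‖ * ‖v‖ := abs_real_inner_le_norm _ _
      _ ≤ (‖T x‖ * ‖v‖) * ‖v‖ := by gcongr; exact (T x).le_opNorm v
      _ = ‖T x‖ := by rw [hv]; ring
      _ ≤ _ := T.le_opNorm x
  have hone : ∀ x y, l x - l y ≤ ‖T‖ * ‖x - y‖ := by
    intro x y
    obtain ⟨v, hv, hvl⟩ := (hl x).2
    have h1 := (hl y).1 v hv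
    have h2 := (abs_le.1 (hinner (x - y) v hv)).2
    rw [map_sub, sub_apply, inner_sub_left] at h2
    linarith
  refine abs_sub_le_iff.2 ⟨hone x y, ?_⟩
  rw [norm_sub_rev]
  exact hone y x

/-- The maximal eigenvalue of a family of symmetric operators depending linearly on a parameter
is strongly semismooth. -/
theorem stronglySemismooth_of_isMaxRayleigh [FiniteDimensional ℝ E] {T : X →L[ℝ] (E →L[ℝ] E)}
    (hT : ∀ x, IsSelfAdjoint (T x)) {l : X → ℝ} (hl : ∀ x, IsMaxRayleigh (T x) (l x)) :
    StronglySemismooth l := by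
  have hlip := abs_sub_le_of_isMaxRayleigh hl
  intro x
  refine .of_differentiableAt ⟨‖T‖₊, Set.univ, univ_mem,
    LipschitzOnWith.of_dist_le_mul fun y _ z _ => ?_⟩ ?_ ?_
  · rw [Real.dist_eq, dist_eq_norm]
    exact hlip y z
  · rw [directionallyDifferentiableAt_iff]
    intro v
    -- As a maximum of functions linear in the parameter, `l` is convex on lines, so right
    -- derivatives exist.
    have hconv : ConvexOn ℝ Set.univ fun t : ℝ => l (x + t • v) := by
      refine ⟨convex_univ, fun s _ t _ a b ha hb hab => ?_⟩
      obtain ⟨w, hw, hwl⟩ := (hl (x + (a • s + b • t) • v)).2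
      have h1 := mul_le_mul_of_nonneg_left ((hl (x + s • v)).1 w hw) ha
      have h2 := mul_le_mul_of_nonneg_left ((hl (x + t • v)).1 w hw) hb
      have e : x + (a • s + b • t) • v = a • (x + s • v) + b • (x + t • v) := by
        have : b = 1 - a := by linarith
        subst this
        module
      simp only [smul_eq_mul] at *
      rw [← hwl, e, map_add, map_smul, map_smul, add_apply, inner_add_left, smul_apply, smul_apply,
        real_inner_smul_left, real_inner_smul_left]
      linarith
    exact ⟨_, hconv.hasDerivWithinAt_rightDeriv_of_mem_interior (x := 0) (by simp)⟩
  -- With `v` a unit top eigenvector at `y`, the error is `-⟪M v, v⟫`, where `M` is positive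
  -- semidefinite. Since `M v = (l x - l y) • v + T (y - x) v` is `O(‖y - x‖)`, the bound of `⟪M v,
  -- v⟫` by `‖M v‖ ^ 2` makes the error quadratic.
  · set M : E →L[ℝ] E := l x • ContinuousLinearMap.id ℝ E - T x with hM
    have hMs : (M : E →ₗ[ℝ] E).IsSymmetric := by
      intro v w
      have := (hT x).isSymmetric v w
      simp only [ContinuousLinearMap.coe_coe] at this ⊢
      simp only [hM, sub_apply, smul_apply, ContinuousLinearMap.id_apply, inner_sub_left,
        inner_sub_right, real_inner_smul_left, real_inner_smul_right, this]
    obtain ⟨C, hC⟩ := hMs.exists_inner_le_mul_norm_sq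
    simp only [ContinuousLinearMap.coe_coe] at hC
    refine ⟨|C| * (2 * ‖T‖) ^ 2, .of_forall fun y hd => ?_⟩
    obtain ⟨v, hv, hvl⟩ := (hl y).2
    have hvy : T y v = l y • v := (hl y).apply_eq (hT y) hv hvl
    have hder : ∀ h, fderiv ℝ l y h = inner ℝ (T h v) v := by
      -- `z ↦ l z - ⟪T z v, v⟫` is minimal at `y`
      let L : X →L[ℝ] ℝ :=
        (innerSL ℝ v).comp ((ContinuousLinearMap.apply ℝ E v).comp T)
      have hL : ∀ h, L h = inner ℝ (T h v) v := fun h => by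
        simp [L, real_inner_comm]
      have hmin : IsLocalMin (fun z => l z - L z) y := by
        refine .of_forall fun z => ?_
        have h1 := (hl z).1 v hv
        simp only [hL]
        linarith
      have h0 := hmin.hasFDerivAt_eq_zero (hd.hasFDerivAt.sub L.hasFDerivAt)
      intro h
      rw [← hL, sub_eq_zero.1 h0]
    have hMv : M v = (l x - l y) • v + T (y - x) v := by
      simp only [hM, sub_apply, smul_apply, ContinuousLinearMap.id_apply, map_sub, hvy]
      module
    have hMn : ‖M v‖ ≤ 2 * ‖T‖ * ‖y - x‖ := by
      rw [hMv]
      calc _ ≤ ‖(l x - l y) • v‖ + ‖T (y - x) v‖ := norm_add_le _ _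
        _ ≤ ‖T‖ * ‖y - x‖ + ‖T‖ * ‖y - x‖ := by
            gcongr
            · rw [norm_smul, hv, mul_one, Real.norm_eq_abs, norm_sub_rev y x]
              exact hlip x y
            · refine ((T (y - x)).le_opNorm v).trans ?_
              rw [hv, mul_one]
              exact T.le_opNorm _
        _ = _ := by ring
    have hMin : inner ℝ (M v) v = l x - inner ℝ (T x v) v := by
      simp [hM, inner_sub_left, real_inner_smul_left, hv]
    have e : l y - l x - fderiv ℝ l y (y - x) = -inner ℝ (M v) v := by
      rw [hder, hMin, map_sub, sub_apply, inner_sub_left, hvl]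
      ring
    have hnn : 0 ≤ inner ℝ (M v) v := by
      rw [hMin]
      linarith [(hl x).1 v hv]
    rw [e, norm_neg, Real.norm_of_nonneg hnn]
    calc _ ≤ C * ‖M v‖ ^ 2 := hC v
      _ ≤ |C| * (2 * ‖T‖ * ‖y - x‖) ^ 2 := by
          gcongr
          exact le_abs_self C
      _ = _ := by ring

end MaximalEigenvalue

/-! ### Invariants of symmetric tensors and the spectrum of the deviator -/

namespace SymTensor

noncomputable section

instance : FiniteDimensional ℝ SymTensor :=
  inferInstanceAs (FiniteDimensional ℝ symmetricMatrices)

/-- The matrix of a symmetric tensor, as a linear map. -/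
def matL : SymTensor →ₗ[ℝ] Matrix (Fin 3) (Fin 3) ℝ where
  toFun := mat
  map_add' _ _ := rfl
  map_smul' _ _ := rfl

theorem matL_apply (σ : SymTensor) : matL σ = σ.mat := rfl

theorem mat_apply_comm (σ : SymTensor) (i j : Fin 3) : σ.mat i j = σ.mat j i :=
  congrFun (congrFun σ.2 j) i

theorem mat_one_apply (i j : Fin 3) : one.mat i j = if i = j then 1 else 0 :=
  Matrix.one_apply

theorem p_eq (σ : SymTensor) : p σ = (σ.mat 0 0 + σ.mat 1 1 + σ.mat 2 2) / 3 := by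
  simp [p, contract, Fin.sum_univ_three, mat_one_apply]

/-- The pressure, as a continuous linear map. -/
def pL : SymTensor →L[ℝ] ℝ :=
  LinearMap.toContinuousLinearMap
    { toFun := p
      map_add' := fun σ τ => by
        simp only [p_eq, ← matL_apply, map_add, Matrix.add_apply]; ring
      map_smul' := fun c σ => by
        simp only [p_eq, ← matL_apply, map_smul, Matrix.smul_apply, smul_eq_mul,
          RingHom.id_apply]
        ring }

theorem pL_apply (σ : SymTensor) : pL σ = p σ := rfl

/-- The deviatoric part, as a continuous linear map. -/
def sL : SymTensor →L[ℝ] SymTensor :=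
  ContinuousLinearMap.id ℝ SymTensor - pL.smulRight one

theorem sL_apply (σ : SymTensor) : sL σ = s σ := rfl

theorem mat_s_apply (σ : SymTensor) (i j : Fin 3) :
    (s σ).mat i j = σ.mat i j - p σ * (if i = j then 1 else 0) := by
  rw [← matL_apply, s, map_sub, map_smul, Matrix.sub_apply, Matrix.smul_apply, matL_apply,
    matL_apply, mat_one_apply, smul_eq_mul]

theorem p_s (σ : SymTensor) : p (s σ) = 0 := by
  rw [p_eq]
  simp only [mat_s_apply, if_true, p_eq]
  ring

theorem sL_sL (σ : SymTensor) : sL (sL σ) = sL σ := by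
  simp only [sL_apply]
  rw [s, p_s, zero_smul, sub_zero]

theorem rho_eq_norm (σ : SymTensor) : rho σ = ‖sL σ‖ := by
  have h : ‖sL σ‖ = (∑ i, ∑ j, ‖(s σ).mat i j‖ ^ (2 : ℝ)) ^ (1 / 2 : ℝ) :=
    Matrix.frobenius_norm_def _
  rw [h, rho, Real.sqrt_eq_rpow, contract]
  congr 1
  refine Finset.sum_congr rfl fun i _ => Finset.sum_congr rfl fun j _ => ?_
  rw [Real.rpow_two, Real.norm_eq_abs, sq_abs, sq]

theorem rho_eq_zero_iff (σ : SymTensor) : rho σ = 0 ↔ sL σ = 0 := by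
  rw [rho_eq_norm, norm_eq_zero]

theorem rho_nonneg (σ : SymTensor) : 0 ≤ rho σ := Real.sqrt_nonneg _

theorem rho_sq (σ : SymTensor) : rho σ ^ 2 = contract (s σ) (s σ) := by
  refine Real.sq_sqrt ?_
  exact Finset.sum_nonneg fun i _ => Finset.sum_nonneg fun j _ => mul_self_nonneg _

theorem contDiffAt_rho {σ : SymTensor} (h : rho σ ≠ 0) : ContDiffAt ℝ 2 rho σ := by
  have h1 : ContDiff ℝ 2 fun σ : SymTensor => contract (s σ) (s σ) := by
    unfold contract
    refine ContDiff.sum fun i _ => ContDiff.sum fun j _ => ?_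
    let L : SymTensor →L[ℝ] ℝ :=
      (LinearMap.toContinuousLinearMap ((Matrix.entryLinearMap ℝ ℝ i j).comp matL)).comp sL
    exact L.contDiff.mul L.contDiff
  refine h1.contDiffAt.sqrt ?_
  rw [← rho_sq]
  exact pow_ne_zero 2 h

/-- The operator on the Euclidean space with a given symmetric matrix. -/
def opL : SymTensor →L[ℝ] (EuclideanSpace ℝ (Fin 3) →L[ℝ] EuclideanSpace ℝ (Fin 3)) :=
  LinearMap.toContinuousLinearMap
    ((Matrix.toEuclideanCLM (n := Fin 3) (𝕜 := ℝ)).toAlgEquiv.toLinearMap.comp matL)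

theorem opL_apply (σ : SymTensor) (v : EuclideanSpace ℝ (Fin 3)) (i : Fin 3) :
    opL σ v i = ∑ j, σ.mat i j * v j := rfl

theorem inner_opL (σ : SymTensor) (v : EuclideanSpace ℝ (Fin 3)) :
    inner ℝ (opL σ v) v = ∑ i, ∑ j, σ.mat i j * v i * v j := by
  simp only [PiLp.inner_apply, opL_apply, RCLike.inner_apply, conj_trivial, Finset.mul_sum]
  refine Finset.sum_congr rfl fun i _ => Finset.sum_congr rfl fun j _ => ?_
  ring

theorem isSelfAdjoint_opL (σ : SymTensor) : IsSelfAdjoint (opL σ) := by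
  have h : IsSelfAdjoint σ.mat := by
    ext i j
    simp [Matrix.star_apply, mat_apply_comm σ j i]
  exact h.map (Matrix.toEuclideanCLM (n := Fin 3) (𝕜 := ℝ))

/-- The maximal eigenvalue. -/
def lamMax (σ : SymTensor) : ℝ := (exists_isMaxRayleigh (opL σ)).choose

theorem isMaxRayleigh_lamMax (σ : SymTensor) : IsMaxRayleigh (opL σ) (lamMax σ) :=
  (exists_isMaxRayleigh (opL σ)).choose_spec

/-- The maximal eigenvalue of the deviatoric part. -/
def devMax (σ : SymTensor) : ℝ := lamMax σ - p σ

theorem norm_sq_eq (v : EuclideanSpace ℝ (Fin 3)) : ‖v‖ ^ 2 = v 0 ^ 2 + v 1 ^ 2 + v 2 ^ 2 := by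
  simp [EuclideanSpace.norm_sq_eq, Fin.sum_univ_three]

theorem inner_opL_s (σ : SymTensor) (v : EuclideanSpace ℝ (Fin 3)) :
    inner ℝ (opL (s σ) v) v = inner ℝ (opL σ v) v - p σ * ‖v‖ ^ 2 := by
  rw [inner_opL, inner_opL, norm_sq_eq]
  simp [mat_s_apply, Fin.sum_univ_three]
  ring

theorem isMaxRayleigh_devMax (σ : SymTensor) : IsMaxRayleigh (opL (s σ)) (devMax σ) := by
  obtain ⟨h1, v, hv, hvl⟩ := isMaxRayleigh_lamMax σ
  refine ⟨fun w hw => ?_, v, hv, ?_⟩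
  · rw [inner_opL_s, hw, devMax]
    linarith [h1 w hw]
  · rw [inner_opL_s, hv, hvl, devMax]
    ring

theorem s_add_smul {x : SymTensor} (hx : s x = 0) (v : SymTensor) (t : ℝ) :
    s (x + t • v) = t • s v := by
  simp only [← sL_apply] at *
  rw [map_add, map_smul, hx, zero_add]

theorem devMax_add_smul {x : SymTensor} (hx : s x = 0) (v : SymTensor) {t : ℝ} (ht : 0 < t) :
    devMax (x + t • v) = t * devMax v := by
  refine IsMaxRayleigh.unique (isMaxRayleigh_devMax _) ?_
  rw [s_add_smul hx, map_smul]
  obtain ⟨h1, w, hw, hwl⟩ := isMaxRayleigh_devMax v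
  refine ⟨fun u hu => ?_, w, hw, ?_⟩
  · rw [smul_apply, real_inner_smul_left]
    exact mul_le_mul_of_nonneg_left (h1 u hu) ht.le
  · rw [smul_apply, real_inner_smul_left, hwl]

theorem rho_add_smul {x : SymTensor} (hx : s x = 0) (v : SymTensor) {t : ℝ} (ht : 0 < t) :
    rho (x + t • v) = t * rho v := by
  rw [rho_eq_norm, rho_eq_norm, sL_apply, s_add_smul hx, norm_smul, Real.norm_of_nonneg ht.le,
    sL_apply]

theorem trace_s (σ : SymTensor) : (s σ).mat 0 0 + (s σ).mat 1 1 + (s σ).mat 2 2 = 0 := by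
  have := p_s σ
  rw [p_eq] at this
  linarith

theorem rho_sq_eq (σ : SymTensor) : rho σ ^ 2 = (s σ).mat 0 0 ^ 2 + (s σ).mat 1 1 ^ 2 +
    (s σ).mat 2 2 ^ 2 + 2 * ((s σ).mat 0 1 ^ 2 + (s σ).mat 0 2 ^ 2 + (s σ).mat 1 2 ^ 2) := by
  rw [rho_sq, contract]
  simp only [Fin.sum_univ_three, mat_apply_comm (s σ) 1 0, mat_apply_comm (s σ) 2 0,
    mat_apply_comm (s σ) 2 1]
  ring

theorem inner_opL_s_eq (σ : SymTensor) (v : EuclideanSpace ℝ (Fin 3)) :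
    inner ℝ (opL (s σ) v) v = (s σ).mat 0 0 * v 0 ^ 2 + (s σ).mat 1 1 * v 1 ^ 2 +
      (s σ).mat 2 2 * v 2 ^ 2 + 2 * ((s σ).mat 0 1 * v 0 * v 1 + (s σ).mat 0 2 * v 0 * v 2 +
      (s σ).mat 1 2 * v 1 * v 2) := by
  rw [inner_opL]
  simp only [Fin.sum_univ_three, mat_apply_comm (s σ) 1 0, mat_apply_comm (s σ) 2 0,
    mat_apply_comm (s σ) 2 1]
  ring

theorem quadForm_le (σ : SymTensor) (x y z : ℝ) :
    (s σ).mat 0 0 * x ^ 2 + (s σ).mat 1 1 * y ^ 2 + (s σ).mat 2 2 * z ^ 2 +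
      2 * ((s σ).mat 0 1 * x * y + (s σ).mat 0 2 * x * z + (s σ).mat 1 2 * y * z)
      ≤ devMax σ * (x ^ 2 + y ^ 2 + z ^ 2) := by
  have h := (isMaxRayleigh_devMax σ).inner_le !₂[x, y, z]
  rw [inner_opL_s_eq, norm_sq_eq] at h
  simpa using h

/-- The diagonal entries of `s` are at most `devMax σ` and sum to zero. -/
theorem devMax_nonneg (σ : SymTensor) : 0 ≤ devMax σ := by
  have h0 := quadForm_le σ 1 0 0
  have h1 := quadForm_le σ 0 1 0
  have h2 := quadForm_le σ 0 0 1
  have := trace_s σ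
  linarith

/-- For a unit maximizer `v`, the squared Frobenius distance from `s` to `(3/2) μ (v ⊗ v - I/3)`
equals `ϱ² - (3/2) μ²`. -/
theorem three_mul_devMax_sq_le (σ : SymTensor) : 3 * devMax σ ^ 2 ≤ 2 * rho σ ^ 2 := by
  obtain ⟨v, hv, hvl⟩ := (isMaxRayleigh_devMax σ).2
  have hq : v 0 ^ 2 + v 1 ^ 2 + v 2 ^ 2 = 1 := by rw [← norm_sq_eq, hv, one_pow]
  rw [inner_opL_s_eq] at hvl
  have ht := trace_s σ
  rw [rho_sq_eq]
  set μ := devMax σ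
  set A := (s σ).mat
  have h : 0 ≤ (A 0 0 - 3 / 2 * μ * (v 0 ^ 2 - 1 / 3)) ^ 2
      + (A 1 1 - 3 / 2 * μ * (v 1 ^ 2 - 1 / 3)) ^ 2
      + (A 2 2 - 3 / 2 * μ * (v 2 ^ 2 - 1 / 3)) ^ 2
      + 2 * ((A 0 1 - 3 / 2 * μ * (v 0 * v 1)) ^ 2 + (A 0 2 - 3 / 2 * μ * (v 0 * v 2)) ^ 2
        + (A 1 2 - 3 / 2 * μ * (v 1 * v 2)) ^ 2) := by positivity
  linear_combination 2 * h + 2 * (-3 * μ) * hvl + 2 * μ * ht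
    + 2 * (9 / 4 * μ ^ 2) * (v 0 ^ 2 + v 1 ^ 2 + v 2 ^ 2 + 1 / 3) * hq

/-- The matrix `μ I - s` is positive semidefinite, so its principal `2 × 2` minors are nonnegative.
As `s` is trace free, they sum to `3 μ² - ϱ² / 2`. -/
theorem rho_sq_le (σ : SymTensor) : rho σ ^ 2 ≤ 6 * devMax σ ^ 2 := by
  have minor : ∀ α β d : ℝ, (∀ x : ℝ, 0 ≤ α * (x * x) + (-2 * d) * x + β) → d ^ 2 ≤ α * β := by
    intro α β d h
    have := discrim_le_zero h
    rw [discrim] at this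
    linarith
  have h01 := minor (devMax σ - (s σ).mat 0 0) (devMax σ - (s σ).mat 1 1) ((s σ).mat 0 1)
    fun x => by linarith [quadForm_le σ x 1 0]
  have h02 := minor (devMax σ - (s σ).mat 0 0) (devMax σ - (s σ).mat 2 2) ((s σ).mat 0 2)
    fun x => by linarith [quadForm_le σ x 0 1]
  have h12 := minor (devMax σ - (s σ).mat 1 1) (devMax σ - (s σ).mat 2 2) ((s σ).mat 1 2)
    fun x => by linarith [quadForm_le σ 0 x 1]
  have ht := trace_s σ
  rw [rho_sq_eq]
  have hc : (s σ).mat 2 2 = -(s σ).mat 0 0 - (s σ).mat 1 1 := by linarith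
  rw [hc] at h02 h12 ⊢
  linarith

/-- This is the characteristic equation of `s`: zero trace makes `J₃` the determinant and `-ϱ² / 2`
the second coefficient. -/
theorem devMax_cubic (σ : SymTensor) :
    devMax σ ^ 3 - rho σ ^ 2 / 2 * devMax σ - J3 σ = 0 := by
  obtain ⟨v, hv, hvl⟩ := (isMaxRayleigh_devMax σ).2
  have hev := (isMaxRayleigh_devMax σ).apply_eq (isSelfAdjoint_opL _) hv hvl
  have hdet : (devMax σ • (1 : Matrix (Fin 3) (Fin 3) ℝ) - (s σ).mat).det = 0 := by
    refine Matrix.exists_mulVec_eq_zero_iff.1 ⟨fun i => v i, ?_, ?_⟩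
    · intro h0
      have : v = 0 := by
        ext i
        exact congrFun h0 i
      simp [this] at hv
    · ext i
      have h1 : opL (s σ) v i = devMax σ * v i := by rw [hev]; rfl
      rw [opL_apply] at h1
      rw [Matrix.sub_mulVec, Matrix.smul_mulVec, Matrix.one_mulVec]
      simp only [Pi.sub_apply, Pi.smul_apply, smul_eq_mul, Matrix.mulVec, dotProduct, h1,
        Pi.zero_apply, sub_self]
  have ht := trace_s σ
  have hc : (s σ).mat 2 2 = -(s σ).mat 0 0 - (s σ).mat 1 1 := by linarith
  rw [J3, rho_sq_eq]
  rw [Matrix.det_fin_three] at hdet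
  simp only [Matrix.trace, Matrix.diag, pow_succ, pow_zero, one_mul, Matrix.mul_apply,
    Fin.sum_univ_three, Matrix.sub_apply, Matrix.smul_apply, Matrix.one_apply, smul_eq_mul,
    mat_apply_comm (s σ) 1 0, mat_apply_comm (s σ) 2 0, mat_apply_comm (s σ) 2 1, hc] at hdet ⊢
  simp only [if_true, if_neg (show (0 : Fin 3) ≠ 1 by decide),
    if_neg (show (0 : Fin 3) ≠ 2 by decide), if_neg (show (1 : Fin 3) ≠ 0 by decide),
    if_neg (show (1 : Fin 3) ≠ 2 by decide), if_neg (show (2 : Fin 3) ≠ 0 by decide),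
    if_neg (show (2 : Fin 3) ≠ 1 by decide)] at hdet
  linear_combination hdet

/-! ### The Lode angle and the function `r_e` -/

/-- The expression of `cos θ` by the maximal eigenvalue. -/
def cosLode (σ : SymTensor) : ℝ := √3 / √2 * (devMax σ / rho σ)

theorem cosLode_mem {σ : SymTensor} (h : rho σ ≠ 0) :
    cosLode σ ∈ Set.Icc (1 / 2 : ℝ) 1 := by
  have hρ : 0 < rho σ := lt_of_le_of_ne (rho_nonneg σ) h.symm
  have h0 := devMax_nonneg σ
  have hsq : cosLode σ ^ 2 = 3 / 2 * devMax σ ^ 2 / rho σ ^ 2 := by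
    rw [cosLode, mul_pow, div_pow, div_pow, Real.sq_sqrt (by norm_num), Real.sq_sqrt (by norm_num)]
    ring
  have hnn : 0 ≤ cosLode σ := by unfold cosLode; positivity
  have h1 : cosLode σ ^ 2 ≤ 1 := by
    rw [hsq, div_le_one (by positivity)]
    linarith [three_mul_devMax_sq_le σ]
  have h2 : 1 / 4 ≤ cosLode σ ^ 2 := by
    rw [hsq, le_div_iff₀ (by positivity)]
    linarith [rho_sq_le σ]
  constructor <;> nlinarith

/-- The cubic equation for `devMax` becomes `4 x³ - 3 x = (3 √3 / 2) J₃ / J₂^(3/2)` for `x = cosLode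
σ`. Since `x ≥ 1/2`, `3 arccos x` lies in `[0, π]`, where `arccos` inverts `cos`. -/
theorem cos_lode {σ : SymTensor} (h : rho σ ≠ 0) : Real.cos (lode σ) = cosLode σ := by
  obtain ⟨hx1, hx2⟩ := cosLode_mem h
  have hρ : 0 < rho σ := lt_of_le_of_ne (rho_nonneg σ) h.symm
  have h2 : (√2) ^ 2 = 2 := Real.sq_sqrt (by norm_num)
  have h3 : (√3) ^ 2 = 3 := Real.sq_sqrt (by norm_num)
  have h2' : 0 < √2 := by positivity
  have hJ2 : J2 σ ^ (3 / 2 : ℝ) = (rho σ / √2) ^ 3 := by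
    have e : J2 σ = (rho σ / √2) ^ (2 : ℝ) := by
      rw [Real.rpow_two, div_pow, h2, rho_sq, J2]
    rw [e, ← Real.rpow_mul (by positivity), ← Real.rpow_natCast]
    norm_num
  have harg : 3 * √3 / 2 * (J3 σ / J2 σ ^ (3 / 2 : ℝ)) = 4 * cosLode σ ^ 3 - 3 * cosLode σ := by
    have hJ3 : J3 σ = devMax σ ^ 3 - rho σ ^ 2 / 2 * devMax σ := by linarith [devMax_cubic σ]
    rw [hJ2, hJ3, cosLode]
    field_simp
    rw [show √2 ^ 6 = ((√2) ^ 2) ^ 3 by ring, h2, h3]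
    ring
  have hφ : 3 * Real.arccos (cosLode σ) ≤ Real.pi := by
    have h1 : Real.arccos (cosLode σ) ≤ Real.arccos (1 / 2) := Real.arccos_le_arccos hx1
    have h2 : Real.arccos (1 / 2) = Real.pi / 3 := by
      rw [← Real.cos_pi_div_three]
      exact Real.arccos_cos (by positivity) (by linarith [Real.pi_pos])
    linarith
  have hcos : Real.cos (Real.arccos (cosLode σ)) = cosLode σ :=
    Real.cos_arccos (by linarith) hx2
  have key : lode σ = Real.arccos (cosLode σ) := by
    have h4 : 4 * cosLode σ ^ 3 - 3 * cosLode σ = Real.cos (3 * Real.arccos (cosLode σ)) := by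
      rw [Real.cos_three_mul, hcos]
    rw [lode, harg, h4, Real.arccos_cos (by have := Real.arccos_nonneg (cosLode σ); positivity) hφ]
    ring
  rw [key, hcos]

theorem contDiffAt_rE {e x : ℝ} (he : e ∈ Set.Icc (1 / 2 : ℝ) 1)
    (hx : x ∈ Set.Icc (1 / 2 : ℝ) 1) : ContDiffAt ℝ 2 (rE e) x := by
  obtain ⟨he1, he2⟩ := he
  obtain ⟨hx1, hx2⟩ := hx
  have hnum : ContDiffAt ℝ 2 (fun x : ℝ => 4 * (1 - e ^ 2) * x ^ 2 + (2 * e - 1) ^ 2) x := by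
    fun_prop
  have hE : 0 ≤ 1 - e ^ 2 := by nlinarith
  -- For `e = 1/2` the radicand vanishes at `x = 1/2`, but the root has coefficient zero. For `e >
  -- 1/2`, `x² ≥ 1/4` bounds the radicand below by `(2 e - 1)² > 0`.
  rcases eq_or_lt_of_le he1 with h | h
  · have : rE e = fun x => (4 * (1 - e ^ 2) * x ^ 2 + (2 * e - 1) ^ 2) /
        (2 * (1 - e ^ 2) * x) := by
      funext x
      rw [rE, show 2 * e - 1 = 0 by linarith, zero_mul, add_zero]
    rw [this]
    refine hnum.div (by fun_prop) ?_
    rw [← h]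
    have : 0 < x := by linarith
    positivity
  · have harg : 0 < 4 * (1 - e ^ 2) * x ^ 2 + 5 * e ^ 2 - 4 * e := by
      nlinarith [mul_nonneg hE (by nlinarith : (0 : ℝ) ≤ x ^ 2 - 1 / 4), sq_pos_of_pos
        (by linarith : 0 < 2 * e - 1)]
    refine hnum.div (ContDiffAt.add (by fun_prop)
      (contDiffAt_const.mul (ContDiffAt.sqrt (by fun_prop) harg.ne'))) ?_
    have h1 : 0 ≤ 2 * (1 - e ^ 2) * x := by
      have : 0 ≤ x := by linarith
      positivity
    have h2 : 0 < (2 * e - 1) * √(4 * (1 - e ^ 2) * x ^ 2 + 5 * e ^ 2 - 4 * e) :=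
      mul_pos (by linarith) (Real.sqrt_pos.2 harg)
    positivity

/-- A normalized Lipschitz function satisfies a weighted Lipschitz estimate. -/
theorem norm_mul_norm_inv_smul_sub_le {Y : Type*} [NormedAddCommGroup Y] [NormedSpace ℝ Y]
    {w : SymTensor → Y} {L : ℝ} (hL : ∀ y z, ‖w y - w z‖ ≤ L * ‖y - z‖)
    (hw : ∀ y, ‖w y‖ ≤ rho y) {y z : SymTensor} (hy : rho y ≠ 0) (hz : rho z ≠ 0) :
    rho y * ‖(rho y)⁻¹ • w y - (rho z)⁻¹ • w z‖ ≤ (L + ‖sL‖) * ‖y - z‖ := by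
  have e : rho y • ((rho y)⁻¹ • w y - (rho z)⁻¹ • w z)
      = (w y - w z) + ((rho z - rho y) * (rho z)⁻¹) • w z := by
    rw [smul_sub, smul_inv_smul₀ hy, sub_mul, mul_inv_cancel₀ hz]
    module
  rw [← Real.norm_of_nonneg (rho_nonneg y), ← norm_smul, Real.norm_of_nonneg (rho_nonneg y), e]
  have h1 : |rho z - rho y| ≤ ‖sL‖ * ‖y - z‖ := by
    rw [rho_eq_norm, rho_eq_norm, norm_sub_rev y z]
    refine (abs_norm_sub_norm_le _ _).trans ?_
    rw [← map_sub]
    exact sL.le_opNorm _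
  have h2 : (rho z)⁻¹ * ‖w z‖ ≤ 1 := by
    rw [inv_mul_le_one₀ (lt_of_le_of_ne (rho_nonneg z) hz.symm)]
    exact hw z
  calc _ ≤ ‖w y - w z‖ + |rho z - rho y| * ((rho z)⁻¹ * ‖w z‖) := by
        refine (norm_add_le _ _).trans ?_
        rw [norm_smul, norm_mul, norm_inv, Real.norm_of_nonneg (rho_nonneg z), Real.norm_eq_abs,
          mul_assoc]
    _ ≤ L * ‖y - z‖ + (‖sL‖ * ‖y - z‖) * 1 := by
        have := rho_nonneg z
        gcongr
        exact hL y z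
    _ = _ := by ring

/-! ### Strong semismoothness of the invariants and products -/

theorem rayStronglySemismoothAt_rho (σ : SymTensor) : RayStronglySemismoothAt rho σ := by
  by_cases h : rho σ = 0
  · exact rayStronglySemismoothAt_of_map_eq_zero sL rho_eq_norm
      (fun y hy => (contDiffAt_rho hy).rayStronglySemismoothAt.directional.self_of_nhds) h
  · exact (contDiffAt_rho h).rayStronglySemismoothAt

theorem rayStronglySemismoothAt_lamMax (σ : SymTensor) : RayStronglySemismoothAt lamMax σ :=
  (stronglySemismooth_of_isMaxRayleigh isSelfAdjoint_opL
    isMaxRayleigh_lamMax).rayStronglySemismoothAt σ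

/-- Away from `ϱ = 0`, `lamMax` is the only ingredient that may fail to be smooth. -/
theorem rayStronglySemismoothAt_rE_cosLode {e : ℝ} (he : e ∈ Set.Icc (1 / 2 : ℝ) 1)
    {σ : SymTensor} (h : rho σ ≠ 0) :
    RayStronglySemismoothAt (fun σ => rE e (cosLode σ)) σ := by
  refine ((rayStronglySemismoothAt_lamMax σ).prodMk
    (rayStronglySemismoothAt_id σ)).contDiffAt_comp
    (φ := fun q : ℝ × SymTensor => rE e (√3 / √2 * ((q.1 - p q.2) / rho q.2))) ?_
  refine ContDiffAt.comp (g := rE e) _ (contDiffAt_rE he (cosLode_mem h)) ?_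
  refine contDiffAt_const.mul (ContDiffAt.div (contDiffAt_fst.sub ?_) ?_ h)
  · exact pL.contDiff.contDiffAt.comp _ contDiffAt_snd
  · exact ContDiffAt.comp (g := rho) _ (contDiffAt_rho h) contDiffAt_snd

theorem abs_devMax_le_rho (σ : SymTensor) : |devMax σ| ≤ rho σ := by
  refine abs_le_of_sq_le_sq ?_ (rho_nonneg σ)
  nlinarith [three_mul_devMax_sq_le σ, sq_nonneg (rho σ), sq_nonneg (devMax σ)]

theorem abs_devMax_sub_le (y z : SymTensor) :
    |devMax y - devMax z| ≤ (‖opL‖ + ‖pL‖) * ‖y - z‖ := by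
  have h1 := abs_sub_le_of_isMaxRayleigh isMaxRayleigh_lamMax y z
  have h2 := pL.le_opNorm (y - z)
  rw [map_sub, pL_apply, pL_apply] at h2
  calc |devMax y - devMax z| = |(lamMax y - lamMax z) - (p y - p z)| := by
        unfold devMax; congr 1; ring
    _ ≤ |lamMax y - lamMax z| + |p y - p z| := abs_sub _ _
    _ ≤ ‖opL‖ * ‖y - z‖ + ‖pL‖ * ‖y - z‖ := add_le_add h1 h2
    _ = _ := by ring

/-- Compactness of `[1/2, 1]` makes `r_e` bounded and Lipschitz there; the ratio `devMax / ϱ`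
supplies the weighted Lipschitz estimate and the constancy on rays. -/
theorem rayStronglySemismoothAt_mul_rE {e : ℝ} (he : e ∈ Set.Icc (1 / 2 : ℝ) 1)
    {a : SymTensor → ℝ} (ha : ∀ σ, RayStronglySemismoothAt a σ) (ha0 : ∀ σ, rho σ = 0 → a σ = 0)
    (σ : SymTensor) : RayStronglySemismoothAt (fun σ => a σ • rE e (cosLode σ)) σ := by
  have hne : ∀ {y}, sL y ≠ 0 → rho y ≠ 0 := fun h h' => h ((rho_eq_zero_iff _).1 h')
  have hC : ContDiffOn ℝ 2 (rE e) (Set.Icc (1 / 2 : ℝ) 1) := fun x hx =>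
    (contDiffAt_rE he hx).contDiffWithinAt
  obtain ⟨K, hK⟩ := hC.exists_lipschitzOnWith (by simp) (convex_Icc _ _) isCompact_Icc
  obtain ⟨B, hB⟩ := isCompact_Icc.exists_bound_of_continuousOn hC.continuousOn
  refine .smul_of_const_on_rays sL sL_sL ha (fun y hy => ha0 y ((rho_eq_zero_iff y).2 hy))
    (B := B) (M := K * (√3 / √2 * (‖opL‖ + ‖pL‖ + ‖sL‖)))
    (fun y hy => hB _ (cosLode_mem (hne hy))) ?_ ?_
    (fun y hy => rayStronglySemismoothAt_rE_cosLode he (hne hy)) σ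
  · intro y z hy hz
    have h1 := hK.norm_sub_le (cosLode_mem (hne hy)) (cosLode_mem (hne hz))
    have h2 := norm_mul_norm_inv_smul_sub_le (w := devMax) abs_devMax_sub_le abs_devMax_le_rho
      (hne hy) (hne hz)
    have e1 : ‖cosLode y - cosLode z‖
        = √3 / √2 * ‖(rho y)⁻¹ • devMax y - (rho z)⁻¹ • devMax z‖ := by
      have e2 : cosLode y - cosLode z
          = √3 / √2 * ((rho y)⁻¹ • devMax y - (rho z)⁻¹ • devMax z) := by
        simp only [cosLode, smul_eq_mul]
        ring
      rw [e2, norm_mul, Real.norm_of_nonneg (by positivity : 0 ≤ √3 / √2)]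
    rw [← rho_eq_norm]
    calc _ ≤ rho y * (K * ‖cosLode y - cosLode z‖) :=
          mul_le_mul_of_nonneg_left h1 (rho_nonneg y)
      _ = K * (√3 / √2 * (rho y * ‖(rho y)⁻¹ • devMax y - (rho z)⁻¹ • devMax z‖)) := by
          rw [e1]; ring
      _ ≤ K * (√3 / √2 * ((‖opL‖ + ‖pL‖ + ‖sL‖) * ‖y - z‖)) := by gcongr
      _ = _ := by ring
  · intro x v hx t ht
    rw [sL_apply] at hx
    rw [cosLode, cosLode, devMax_add_smul hx v ht, rho_add_smul hx v ht,
      mul_div_mul_left _ _ ht.ne']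

theorem rayStronglySemismoothAt_smul_n
    {a : SymTensor → ℝ} (ha : ∀ σ, RayStronglySemismoothAt a σ) (ha0 : ∀ σ, rho σ = 0 → a σ = 0)
    (σ : SymTensor) : RayStronglySemismoothAt (fun σ => a σ • n σ) σ := by
  have hne : ∀ {y}, sL y ≠ 0 → rho y ≠ 0 := fun h h' => h ((rho_eq_zero_iff _).1 h')
  refine .smul_of_const_on_rays sL sL_sL ha (fun y hy => ha0 y ((rho_eq_zero_iff y).2 hy))
    (B := 1) (M := ‖sL‖ + ‖sL‖) ?_ ?_ ?_ ?_ σ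
  · intro y hy
    rw [n, norm_smul, norm_inv, Real.norm_of_nonneg (rho_nonneg y), ← sL_apply, ← rho_eq_norm,
      inv_mul_cancel₀ (hne hy)]
  · intro y z hy hz
    rw [← rho_eq_norm]
    refine norm_mul_norm_inv_smul_sub_le (w := s) (fun y z => ?_)
      (fun y => (rho_eq_norm y).ge) (hne hy) (hne hz)
    simp only [← sL_apply]
    rw [← map_sub]
    exact sL.le_opNorm _
  · intro x v hx t ht
    rw [sL_apply] at hx
    rw [n, n, rho_add_smul hx v ht, s_add_smul hx, smul_smul, mul_inv_rev, mul_assoc,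
      inv_mul_cancel₀ ht.ne', mul_one]
  · intro y hy
    exact (((contDiffAt_rho (hne hy)).inv (hne hy)).smul
      sL.contDiff.contDiffAt).rayStronglySemismoothAt

theorem rhoHatE_eq (e : ℝ) {a : SymTensor → ℝ} (ha0 : ∀ σ, rho σ = 0 → a σ = 0) :
    rhoHatE e a = fun σ => a σ • rE e (cosLode σ) := by
  funext σ
  by_cases h : rho σ = 0
  · simp [rhoHatE, h, ha0 σ h]
  · simp [rhoHatE, h, cos_lode h]

theorem rhoE_eq (e : ℝ) : rhoE e = fun σ => rho σ • rE e (cosLode σ) := by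
  funext σ
  by_cases h : rho σ = 0
  · simp [rhoE, h]
  · simp [rhoE, cos_lode h]

/-- No case distinction remains, because `0⁻¹ = 0` makes `n` vanish where `ϱ = 0`. -/
theorem S_eq (a b : SymTensor → ℝ) : S a b = fun σ => a σ • one + b σ • n σ := by
  funext σ
  by_cases h : rho σ = 0
  · simp [S, n, h]
  · simp [S, h]

end

end SymTensor

theorem mainTheorem8 (e : ℝ) (he : e ∈ Set.Icc (1 / 2 : ℝ) 1) :
    StronglySemismooth SymTensor.rho ∧
    StronglySemismooth (SymTensor.rhoE e) ∧
    ∀ pHat rhoHat : SymTensor → ℝ,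
      StronglySemismooth pHat → StronglySemismooth rhoHat →
      (∀ σ : SymTensor, SymTensor.rho σ = 0 → rhoHat σ = 0) →
      StronglySemismooth (SymTensor.rhoHatE e rhoHat) ∧
      StronglySemismooth (SymTensor.S pHat rhoHat) := by
  refine ⟨fun σ => (SymTensor.rayStronglySemismoothAt_rho σ).stronglySemismoothAt, ?_, ?_⟩
  · rw [SymTensor.rhoE_eq]
    exact fun σ => (SymTensor.rayStronglySemismoothAt_mul_rE he
      SymTensor.rayStronglySemismoothAt_rho (fun _ h => h) σ).stronglySemismoothAt
  · intro pHat rhoHat hp hrho h0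
    rw [SymTensor.rhoHatE_eq e h0, SymTensor.S_eq]
    refine ⟨fun σ => (SymTensor.rayStronglySemismoothAt_mul_rE he hrho.rayStronglySemismoothAt
      h0 σ).stronglySemismoothAt, fun σ => ?_⟩
    exact (((hp.rayStronglySemismoothAt σ).smul
      contDiffAt_const.rayStronglySemismoothAt).add
      (SymTensor.rayStronglySemismoothAt_smul_n hrho.rayStronglySemismoothAt h0
        σ)).stronglySemismoothAt
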